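/- Let $d\ge 1$ be an integer, let $a>0$, and let $\alpha\in L_1([0,\infty),r^{d-1}\,dr)\cap L_2([0,\infty),r^{d-1}\,dr)$ be real-valued and not almost everywhere zero. Say that $\alpha$ *generates a radial uniform averaging kernel on $\mathbb{R}^d$ for the translates of the ball of radius $a$* if, with $\omega=\{x\in\mathbb{R}^d:\|x\|_2\le a\}$ and $A(x,y)=\alpha(\|x-y\|_2)$, there is a real Hilbert space $\mathcal H$ which contains as a dense subspace a vector space $V$ of real functions on $\mathbb{R}^d$ (modulo equality almost everywhere, integrable over every ball $y+\omega$), such that for every $y\in\mathbb{R}^d$ the averaging functional $\lambda_y(f)=\frac1{|\omega|}\int_{y+\omega}f(x)\,dx$ on $V$ extends to a continuous linear functional on $\mathcal H$, and $A(\cdot,y)\in V$ represents it: $\lambda_y(f)=\langle f,A(\cdot,y)\rangle_{\mathcal H}$ for all $f\in\mathcal H$. (Thus $\mathcal H$ may be a complete space of functions, such as $L_2(\mathbb{R}^d)$, or the completion of a pre-Hilbert space of functions.) For real $\nu$ and $x>0$ let $J_\nu(x)=\sum_{k\ge0}\frac{(-1)^k}{k!\,\Gamma(k+\nu+1)}(x/2)^{2k+\nu}$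 be the Bessel function of the first kind, and let $0<j_1<j_2<\cdots$ be the positive zeros of $s\mapsto J_{d/2}(as)$. Then $\alpha$ generates a radial uniform averaging kernel on $\mathbb{R}^d$ for the translates of the ball of radius $a$ if and only if $\alpha$ is the inverse Hankel transform of order $\frac d2-1$ of a real function $\hat\alpha\in C_0([0,\infty))\cap L_2([0,\infty),s^{d-1}\,ds)$, i.e. $$\alpha(r)=\lim_{R\to\infty} r^{-\frac{d-2}{2}}\int_0^R\hat\alpha(s)\,s^{\frac d2}J_{\frac{d-2}{2}}(sr)\,ds\quad\text{in } L_2([0,\infty),r^{d-1}\,dr),$$ such that $$\hat\alpha(s)\ \begin{cases}\ge 0 & \text{if } s\in[0,j_1],\\ \le 0 & \text{if } s\in[j_{2k-1},j_{2k}],\ k\ge1,\\ \ge 0 & \text{if } s\in[j_{2k},j_{2k+1}],\ k\ge 1.\end{cases}$$ -/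

import Mathlib

open MeasureTheory Set Filter Topology
open scoped ENNReal

noncomputable section

/-- A real Hilbert space of functions on `E`, functions being identified when they agree almost
everywhere. The Hilbert space `H` is allowed to be the abstract completion of a pre-Hilbert space
of functions: the elements of the dense subspace `core` are functions, via the injective linear
map `toFun`. When `core = ⊤`, every element of `H` is a function (as for `L²(E)`). -/
structure FunctionHilbertSpace (E : Type) [MeasureSpace E] where
  H : Type
  [normed : NormedAddCommGroup H]
  [innerProduct : InnerProductSpace ℝ H]
  [complete : CompleteSpace H]
  core : Submodule ℝ H
  dense_core : Dense (core : Set H)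
  toFun : core →ₗ[ℝ] (E →ₘ[volume] ℝ)
  toFun_injective : Function.Injective toFun

attribute [instance] FunctionHilbertSpace.normed FunctionHilbertSpace.innerProduct
  FunctionHilbertSpace.complete

/-- `A` is the averaging kernel of the Hilbert space `X` of functions for the domains `ω τ`: the
averages over `ω τ` make sense for the functions in `X` and define continuous linear functionals
`lam τ` on `X`, and the function `A(·, τ)` is an element of `X` which represents `lam τ` in the
inner product of `X`. -/
def FunctionHilbertSpace.HasAveragingKernel {E T : Type} [MeasureSpace E]
    (X : FunctionHilbertSpace E) (ω : T → Set E) (A : E → T → ℝ) : Prop :=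
  (∀ (f : X.core) (τ : T), IntegrableOn (X.toFun f) (ω τ)) ∧
  ∃ lam : T → (X.H →L[ℝ] ℝ),
    (∀ (τ : T) (f : X.core), lam τ f = ⨍ x in ω τ, X.toFun f x) ∧
    ∀ τ : T, ∃ g : X.core, (X.toFun g =ᵐ[volume] fun x => A x τ) ∧
      ∀ f : X.H, lam τ f = inner ℝ f (g : X.H)

/-- `A` is an averaging kernel for the domains `ω τ`: it is the averaging kernel of some Hilbert
space of functions. -/
def IsAveragingKernel {E T : Type} [MeasureSpace E] (ω : T → Set E) (A : E → T → ℝ) : Prop :=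
  ∃ X : FunctionHilbertSpace E, X.HasAveragingKernel ω A

/-- A uniform averaging kernel: the domains are the translates `y + ω` of a single set `ω`. -/
def IsUniformAveragingKernel {d : ℕ} (ω : Set (EuclideanSpace ℝ (Fin d)))
    (A : EuclideanSpace ℝ (Fin d) → EuclideanSpace ℝ (Fin d) → ℝ) : Prop :=
  IsAveragingKernel (fun y => (fun x => y + x) '' ω) A

/-- The profile `α` generates the radial uniform averaging kernel `A(x, y) = α(‖x - y‖)` on `ℝ^d`
for the translates of the ball of radius `a`. -/
def GeneratesRadialAveragingKernel (d : ℕ) (a : ℝ) (α : ℝ → ℝ) : Prop :=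
  IsUniformAveragingKernel (d := d) (Metric.closedBall 0 a) (fun x y => α ‖x - y‖)

/-- The measure `r^(d-1) dr` on `[0, ∞)`. -/
def radialMeasure (d : ℕ) : Measure ℝ :=
  (volume.restrict (Ici (0 : ℝ))).withDensity (fun r => ENNReal.ofReal (r ^ (d - 1)))

/-- The Bessel function `J_ν(x)` of the first kind of real order `ν`, for `x > 0`. -/
def besselJ (ν x : ℝ) : ℝ :=
  ∑' k : ℕ, (-1) ^ k / (k.factorial * Real.Gamma (k + ν + 1)) * (x / 2) ^ (2 * (k : ℝ) + ν)

/-- `besselZero ν a k` is, for `k ≥ 1`, the `k`-th positive zero of `s ↦ J_ν(a s)`; the value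
for `k = 0` is `0`. -/
def besselZero (ν a : ℝ) : ℕ → ℝ
  | 0 => 0
  | k + 1 => sInf {s : ℝ | besselZero ν a k < s ∧ besselJ ν (a * s) = 0}

/-- The Hankel transform of order `d/2 - 1` of the restriction of `β` to `[0, R]`, namely
`r ↦ r^(-(d/2-1)) ∫_0^R β(s) s^(d/2) J_{d/2-1}(s r) ds` for `r > 0`. -/
def truncatedHankel (d : ℕ) (β : ℝ → ℝ) (R r : ℝ) : ℝ :=
  r ^ (-((d : ℝ) / 2 - 1)) *
    ∫ s in Ioc 0 R, β s * s ^ ((d : ℝ) / 2) * besselJ ((d : ℝ) / 2 - 1) (s * r)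

/-- `α` is the (inverse) Hankel transform of order `d/2 - 1` of `β` in the sense of Plancherel:
the transforms of the truncations of `β` to `[0, R]` converge to `α` in `L²([0, ∞), r^(d-1))`
as `R → ∞`. The transform is an involution, so it is its own inverse. -/
def IsInverseHankelTransform (d : ℕ) (β α : ℝ → ℝ) : Prop :=
  Tendsto (fun R : ℝ => eLpNorm (fun r => truncatedHankel d β R r - α r) 2 (radialMeasure d))
    atTop (𝓝 0)

/-- The sign pattern of `s ↦ J_{d/2}(a s)`: nonnegative up to the first positive zero, then
alternating in sign between consecutive zeros. -/
def HasBesselSignPattern (d : ℕ) (a : ℝ) (β : ℝ → ℝ) : Prop :=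
  (∀ s ∈ Icc 0 (besselZero ((d : ℝ) / 2) a 1), 0 ≤ β s) ∧
  ∀ k : ℕ, 1 ≤ k →
    (∀ s ∈ Icc (besselZero ((d : ℝ) / 2) a (2 * k - 1)) (besselZero ((d : ℝ) / 2) a (2 * k)),
      β s ≤ 0) ∧
    (∀ s ∈ Icc (besselZero ((d : ℝ) / 2) a (2 * k)) (besselZero ((d : ℝ) / 2) a (2 * k + 1)),
      0 ≤ β s)

end

open scoped FourierTransform

/-
In terms of the symmetric set `ω`, a kernel `g (x - y)` represents the averages over the translates
`y + ω` exactly if `⟨g (· - z), g (· - y)⟩` is the average of `g (· - y)` over `z + ω`, that is, if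
the Gram matrix of the representers is the translation invariant kernel given by the convolution of
`g` with `|ω|⁻¹ 1_ω`. On the Fourier side this convolution is `|ω|⁻¹ ĝ 1̂_ω`, so positivity of Gram
matrices forces `ĝ 1̂_ω ≥ 0`. Conversely, if `ĝ 1̂_ω ≥ 0`, its square root times the characters is a
family in `L²` with the required Gram matrix. The linear extension of
`√(|ω|⁻¹ ĝ 1̂_ω) e_y ↦ g (· - y)` is well defined and injective as soon as `1̂_ω` vanishes only on
a null set.

For the ball, `1̂_ω` is a positive multiple of the entire function `(as) ^ (-d/2) J_{d/2}(as)` of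
`s = 2π‖ξ‖`, while for the radial function `g = α ∘ ‖·‖` the transform `ĝ` is radial and, by
Plancherel's theorem, its profile is the Hankel transform of `α` in the sense of `L²`. Hence the
condition is that this profile has the sign of `J_{d/2}(as)`. The zeros of `J_{d/2}` are simple,
because two consecutive Bessel functions have no common positive zero, and unbounded by Sturm
comparison, which gives the alternating sign pattern on the whole half line.
-/

section PowerSeries

open FormalMultilinearSeries

variable {𝕜 : Type*} [NontriviallyNormedField 𝕜] [CompleteSpace 𝕜] {c : ℕ → 𝕜}

lemma hasFPowerSeriesOnBall_ofScalarsSum (hc : (ofScalars 𝕜 c).radius = ⊤) :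
    HasFPowerSeriesOnBall (ofScalarsSum (E := 𝕜) c) (ofScalars 𝕜 c) 0 ⊤ :=
  hc ▸ (ofScalars 𝕜 c).hasFPowerSeriesOnBall (hc ▸ ENNReal.zero_lt_top)

lemma hasSum_ofScalarsSum (hc : (ofScalars 𝕜 c).radius = ⊤) (t : 𝕜) :
    HasSum (fun k => c k * t ^ k) (ofScalarsSum c t) := by
  simpa [ofScalars_apply_eq, mul_comm] using
    (hasFPowerSeriesOnBall_ofScalarsSum hc).hasSum (y := t) (by simp)

lemma hasSum_deriv_ofScalarsSum (hc : (ofScalars 𝕜 c).radius = ⊤) (t : 𝕜) :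
    HasSum (fun k : ℕ => (k + 1) * c (k + 1) * t ^ k) (deriv (ofScalarsSum c) t) := by
  have h := ((hasFPowerSeriesOnBall_ofScalarsSum hc).fderiv.hasSum (y := t) (by simp)).mapL
    (ContinuousLinearMap.apply 𝕜 𝕜 1)
  simpa [apply_eq_pow_smul_coeff, mul_comm] using h

end PowerSeries

section BesselClifford

open FormalMultilinearSeries

/-- The coefficients `1 / (k! Γ(k + ν + 1))` of the Bessel–Clifford function. Since `Γ` takes the
junk value `0` at its poles, the coefficient vanishes there, in accordance with the zeros of the
entire function `1 / Γ`. -/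
noncomputable def besselCliffordCoeff (ν : ℝ) (k : ℕ) : ℝ :=
  (k.factorial * Real.Gamma (k + ν + 1))⁻¹

/-- The Bessel–Clifford function `∑ t ^ k / (k! Γ(k + ν + 1))`, the entire function for which
`J_ν(x) = (x / 2) ^ ν * besselClifford ν (-(x² / 4))`. -/
noncomputable def besselClifford (ν : ℝ) : ℝ → ℝ :=
  ofScalarsSum (besselCliffordCoeff ν)

lemma succ_mul_besselCliffordCoeff_succ (ν : ℝ) (k : ℕ) :
    (k + 1) * besselCliffordCoeff ν (k + 1) = besselCliffordCoeff (ν + 1) k := by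
  have hk : (k : ℝ) + 1 ≠ 0 := by positivity
  rw [besselCliffordCoeff, besselCliffordCoeff, Nat.factorial_succ,
    show ((k + 1 : ℕ) : ℝ) + ν + 1 = k + (ν + 1) + 1 by push_cast; ring]
  push_cast
  rw [mul_assoc, mul_inv, mul_inv_cancel_left₀ hk]

lemma besselCliffordCoeff_eq_mul (ν : ℝ) (k : ℕ) :
    besselCliffordCoeff ν k = (k + ν + 1) * besselCliffordCoeff (ν + 1) k := by
  rw [besselCliffordCoeff, besselCliffordCoeff, ← add_assoc (k : ℝ)]
  rcases eq_or_ne (k + ν + 1) 0 with h | h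
  · simp [h]
  · rw [Real.Gamma_add_one h]
    field_simp

lemma besselCliffordCoeff_ne_zero {ν : ℝ} {k : ℕ} (h : -1 < k + ν) :
    besselCliffordCoeff ν k ≠ 0 :=
  inv_ne_zero (mul_ne_zero (by positivity) (Real.Gamma_pos_of_pos (by linarith)).ne')

lemma radius_besselCliffordCoeff (ν : ℝ) :
    (ofScalars ℝ (besselCliffordCoeff ν)).radius = ⊤ := by
  have hlim : Tendsto (fun k : ℕ => (k : ℝ) + 1 + ν) atTop atTop :=
    tendsto_atTop_add_const_right _ _
      (tendsto_atTop_add_const_right _ _ tendsto_natCast_atTop_atTop)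
  have hne : ∀ᶠ k in atTop, besselCliffordCoeff ν k ≠ 0 := by
    filter_upwards [hlim.eventually_gt_atTop 0] with k hk
    exact besselCliffordCoeff_ne_zero (by linarith)
  refine ofScalars_radius_eq_top_of_tendsto ℝ _ hne ?_
  refine (tendsto_inv_atTop_zero.comp
    ((tendsto_atTop_add_const_right _ 1 tendsto_natCast_atTop_atTop).atTop_mul_atTop₀ hlim)).congr'
    ?_
  filter_upwards [hne, hlim.eventually_gt_atTop 0] with k hk hpos
  have hratio : besselCliffordCoeff ν k =
      (((k : ℝ) + 1) * (k + 1 + ν)) * besselCliffordCoeff ν (k + 1) := by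
    rw [besselCliffordCoeff_eq_mul, ← succ_mul_besselCliffordCoeff_succ]
    ring
  have hk' : besselCliffordCoeff ν (k + 1) ≠ 0 := right_ne_zero_of_mul (hratio ▸ hk)
  have hpos' : 0 < ((k : ℝ) + 1) * (k + 1 + ν) := mul_pos (by positivity) hpos
  rw [hratio, norm_mul, Real.norm_of_nonneg hpos'.le, Function.comp_apply]
  field_simp

lemma analyticOnNhd_besselClifford (ν : ℝ) : AnalyticOnNhd ℝ (besselClifford ν) univ := by
  rw [← Metric.eball_top (0 : ℝ)]
  exact (hasFPowerSeriesOnBall_ofScalarsSum (radius_besselCliffordCoeff ν)).analyticOnNhd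

lemma hasSum_besselClifford (ν t : ℝ) :
    HasSum (fun k => besselCliffordCoeff ν k * t ^ k) (besselClifford ν t) :=
  hasSum_ofScalarsSum (radius_besselCliffordCoeff ν) t

lemma deriv_besselClifford (ν : ℝ) : deriv (besselClifford ν) = besselClifford (ν + 1) := by
  funext t
  refine (hasSum_deriv_ofScalarsSum (radius_besselCliffordCoeff ν) t).unique ?_
  simpa only [succ_mul_besselCliffordCoeff_succ] using hasSum_besselClifford (ν + 1) t

lemma hasDerivAt_besselClifford (ν t : ℝ) :
    HasDerivAt (besselClifford ν) (besselClifford (ν + 1) t) t := by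
  rw [← deriv_besselClifford]
  exact (analyticOnNhd_besselClifford ν t (mem_univ t)).differentiableAt.hasDerivAt

lemma iteratedDeriv_besselClifford (ν : ℝ) (n : ℕ) :
    iteratedDeriv n (besselClifford ν) = besselClifford (ν + n) := by
  induction n with
  | zero => simp
  | succ n ih => rw [iteratedDeriv_succ, ih, deriv_besselClifford, Nat.cast_succ, add_assoc]

lemma besselClifford_zero (ν : ℝ) : besselClifford ν 0 = (Real.Gamma (ν + 1))⁻¹ := by
  simp [besselClifford, besselCliffordCoeff]

lemma besselClifford_zero_pos {ν : ℝ} (hν : -1 < ν) : 0 < besselClifford ν 0 :=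
  besselClifford_zero ν ▸ inv_pos.2 (Real.Gamma_pos_of_pos (by linarith))

lemma besselClifford_eq_add (ν t : ℝ) :
    besselClifford ν t =
      (ν + 1) * besselClifford (ν + 1) t + t * besselClifford (ν + 2) t := by
  have hshift : HasSum (fun k : ℕ => k * besselCliffordCoeff (ν + 1) k * t ^ k)
      (t * besselClifford (ν + 2) t) := by
    have h := (hasSum_besselClifford (ν + 2) t).mul_left t
    rw [← hasSum_nat_add_iff' 1]
    simp only [Finset.range_one, Finset.sum_singleton, Nat.cast_zero, zero_mul, sub_zero]
    refine h.congr_fun fun k => ?_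
    rw [Nat.cast_succ, succ_mul_besselCliffordCoeff_succ, show ν + 1 + 1 = ν + 2 by ring]
    ring
  refine (hasSum_besselClifford ν t).unique
    ((((hasSum_besselClifford (ν + 1) t).mul_left (ν + 1)).add hshift).congr_fun fun k => ?_)
  rw [besselCliffordCoeff_eq_mul]
  ring

/-- By the recurrence a common zero of two consecutive functions is a zero of all later ones,
which are the iterated derivatives. -/
lemma besselClifford_succ_ne_zero {ν t : ℝ} (ht : t ≠ 0) (h : besselClifford ν t = 0) :
    besselClifford (ν + 1) t ≠ 0 := by
  intro h'
  have hall : ∀ n : ℕ, besselClifford (ν + n) t = 0 ∧ besselClifford (ν + n + 1) t = 0 := by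
    intro n
    induction n with
    | zero => simpa using ⟨h, h'⟩
    | succ n ih =>
      have hrec := besselClifford_eq_add (ν + n) t
      rw [ih.1, ih.2, mul_zero, zero_add, eq_comm, mul_eq_zero, or_iff_right ht] at hrec
      push_cast
      exact ⟨by rw [← add_assoc, ih.2], by rw [← hrec]; congr 1; ring⟩
  have hflat : ∀ n : ℕ, n ≤ analyticOrderAt (besselClifford ν) t := fun n =>
    (natCast_le_analyticOrderAt_iff_iteratedDeriv_eq_zero
      (analyticOnNhd_besselClifford ν t (mem_univ t))).2 fun i _ => by
        rw [iteratedDeriv_besselClifford, (hall i).1]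
  have hzero : besselClifford ν = 0 :=
    (analyticOnNhd_besselClifford ν).eq_of_eventuallyEq analyticOnNhd_const
      (analyticOrderAt_eq_top.1 (ENat.eq_top_iff_forall_ge.2 hflat))
  obtain ⟨n, hn⟩ := exists_nat_gt (-ν)
  have hpos := besselClifford_zero_pos (ν := ν + n) (by linarith)
  rw [← iteratedDeriv_besselClifford, hzero, iteratedDeriv_const_zero] at hpos
  exact hpos.false

end BesselClifford

section ReducedBessel

/-- The reduced Bessel function `(x / 2) ^ (-ν) * J_ν(x)`, extended to an even entire function. -/
noncomputable def reducedBesselJ (ν x : ℝ) : ℝ := besselClifford ν (-(x ^ 2 / 4))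

lemma besselJ_eq_rpow_mul {ν x : ℝ} (hx : 0 < x) :
    besselJ ν x = (x / 2) ^ ν * reducedBesselJ ν x := by
  refine HasSum.tsum_eq (((hasSum_besselClifford ν _).mul_left _).congr_fun fun k => ?_)
  rw [Real.rpow_add (by positivity), besselCliffordCoeff, ← Nat.cast_ofNat, ← Nat.cast_mul,
    Real.rpow_natCast, Nat.cast_ofNat, pow_mul, show -(x ^ 2 / 4) = -1 * (x / 2) ^ 2 by ring,
    mul_pow]
  ring

lemma besselJ_eq_zero_iff {ν x : ℝ} (hx : 0 < x) :
    besselJ ν x = 0 ↔ reducedBesselJ ν x = 0 := by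
  rw [besselJ_eq_rpow_mul hx, mul_eq_zero, or_iff_right (by positivity)]

lemma reducedBesselJ_zero_pos {ν : ℝ} (hν : -1 < ν) : 0 < reducedBesselJ ν 0 := by
  simpa [reducedBesselJ] using besselClifford_zero_pos hν

lemma hasDerivAt_reducedBesselJ (ν x : ℝ) :
    HasDerivAt (reducedBesselJ ν) (-(x / 2) * reducedBesselJ (ν + 1) x) x := by
  have hsq : HasDerivAt (fun x : ℝ => -(x ^ 2 / 4)) (-(x / 2)) x := by
    refine ((hasDerivAt_pow 2 x).div_const 4).neg.congr_deriv ?_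
    push_cast
    ring
  exact ((hasDerivAt_besselClifford ν _).comp x hsq).congr_deriv (mul_comm _ _)

lemma continuous_reducedBesselJ (ν : ℝ) : Continuous (reducedBesselJ ν) :=
  continuous_iff_continuousAt.2 fun x => (hasDerivAt_reducedBesselJ ν x).continuousAt

lemma reducedBesselJ_eq_sub (ν x : ℝ) :
    reducedBesselJ ν x =
      (ν + 1) * reducedBesselJ (ν + 1) x - x ^ 2 / 4 * reducedBesselJ (ν + 2) x := by
  simp only [reducedBesselJ]
  rw [besselClifford_eq_add]
  ring

lemma reducedBesselJ_succ_ne_zero {ν x : ℝ} (hx : x ≠ 0) (h : reducedBesselJ ν x = 0) :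
    reducedBesselJ (ν + 1) x ≠ 0 :=
  besselClifford_succ_ne_zero (neg_ne_zero.2 (by positivity)) h

end ReducedBessel

section RealZeros

variable {X : Type*} [TopologicalSpace X] {f : ℝ → ℝ}

lemma pos_of_isPreconnected_of_ne_zero {g : X → ℝ} {s : Set X} (hs : IsPreconnected s)
    (hg : ContinuousOn g s) (hne : ∀ x ∈ s, g x ≠ 0) {x y : X} (hx : x ∈ s) (hy : y ∈ s)
    (hpos : 0 < g x) : 0 < g y := by
  by_contra! hle
  obtain ⟨z, hz, hz0⟩ := hs.intermediate_value hy hx hg ⟨hle, hpos.le⟩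
  exact hne z hz hz0

lemma csInf_zeros_mem (hf : Continuous f) {z : ℝ} (hz : ∀ᶠ s in 𝓝[>] z, f s ≠ 0)
    (hne : {s | z < s ∧ f s = 0}.Nonempty) :
    sInf {s | z < s ∧ f s = 0} ∈ {s | z < s ∧ f s = 0} := by
  obtain ⟨u, hzu, hu⟩ := mem_nhdsGT_iff_exists_Ioo_subset.1 hz
  have heq : {s | z < s ∧ f s = 0} = Ici u ∩ f ⁻¹' {0} := by
    ext s
    exact ⟨fun hs => ⟨not_lt.1 fun hsu => hu ⟨hs.1, hsu⟩ hs.2, hs.2⟩,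
      fun hs => ⟨lt_of_lt_of_le hzu hs.1, hs.2⟩⟩
  rw [heq] at hne ⊢
  exact (isClosed_Ici.inter (isClosed_singleton.preimage hf)).csInf_mem hne
    ⟨u, fun s hs => hs.1⟩

lemma neg_on_Ioo_of_simple_zero (hf : Continuous f) {x y z f' : ℝ} (hxz : x < z) (hzy : z < y)
    (hd : HasDerivAt f f' z) (hz : f z = 0) (hf' : f' ≠ 0) (hpos : ∀ t ∈ Ioo x z, 0 < f t)
    (hne : ∀ t ∈ Ioo z y, f t ≠ 0) : ∀ t ∈ Ioo z y, f t < 0 := by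
  have hneg : f' < 0 := by
    refine hf'.lt_or_gt.resolve_right fun hf' => ?_
    have hsign := eventually_nhdsWithin_sign_eq_of_deriv_pos (hd.deriv.symm ▸ hf') hz
    obtain ⟨t, htsign, ht⟩ :=
      ((hsign.filter_mono nhdsWithin_le_nhds).and (Ioo_mem_nhdsLT hxz)).exists
    rw [sign_pos (hpos t ht), sign_neg (sub_neg.2 ht.2)] at htsign
    exact absurd htsign (by decide)
  have hsign := eventually_nhdsWithin_sign_eq_of_deriv_neg (hd.deriv.symm ▸ hneg) hz
  obtain ⟨u, husign, hu⟩ :=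
    ((hsign.filter_mono nhdsWithin_le_nhds).and (Ioo_mem_nhdsGT hzy)).exists
  rw [sign_neg (sub_neg.2 hu.1), sign_eq_neg_one_iff] at husign
  intro t ht
  exact neg_pos.1 (pos_of_isPreconnected_of_ne_zero isPreconnected_Ioo hf.neg.continuousOn
    (fun s hs => neg_ne_zero.2 (hne s hs)) hu ht (neg_pos.2 husign))

/-- Sturm comparison with `sin (k (x - c))`: the Wronskian is decreasing as long as `w` is
positive, whereas its boundary values are `-k w(c) < 0` and `k w(c + π / k) > 0`. -/
lemma exists_nonpos_of_sturm {w w' q : ℝ → ℝ} {c k : ℝ} (hk : 0 < k)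
    (hw : ∀ x ∈ Icc c (c + Real.pi / k), HasDerivAt w (w' x) x)
    (hw' : ∀ x ∈ Icc c (c + Real.pi / k), HasDerivAt w' (-(q x * w x)) x)
    (hq : ∀ x ∈ Icc c (c + Real.pi / k), k ^ 2 ≤ q x) :
    ∃ x ∈ Icc c (c + Real.pi / k), w x ≤ 0 := by
  by_contra! hpos
  have hle : c ≤ c + Real.pi / k := le_add_of_nonneg_right (by positivity)
  let F : ℝ → ℝ := fun x => w' x * Real.sin (k * (x - c)) - w x * (k * Real.cos (k * (x - c)))
  have hF : ∀ x ∈ Icc c (c + Real.pi / k),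
      HasDerivAt F (-((q x - k ^ 2) * w x * Real.sin (k * (x - c)))) x := fun x hx => by
    have hlin : HasDerivAt (fun x => k * (x - c)) k x := by
      simpa using ((hasDerivAt_id x).sub_const c).const_mul k
    refine (((hw' x hx).mul hlin.sin).sub ((hw x hx).mul (hlin.cos.const_mul k))).congr_deriv ?_
    ring
  have hanti : AntitoneOn F (Icc c (c + Real.pi / k)) := by
    refine antitoneOn_of_hasDerivWithinAt_nonpos (convex_Icc _ _)
      (fun x hx => (hF x hx).continuousAt.continuousWithinAt)
      (fun x hx => (hF x (interior_subset hx)).hasDerivWithinAt) fun x hx => ?_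
    have hx := interior_subset hx
    have hsin : 0 ≤ Real.sin (k * (x - c)) :=
      Real.sin_nonneg_of_nonneg_of_le_pi (mul_nonneg hk.le (sub_nonneg.2 hx.1))
        (by rw [← le_div_iff₀' hk]; linarith [hx.2])
    exact neg_nonpos.2 (mul_nonneg (mul_nonneg (sub_nonneg.2 (hq x hx)) (hpos x hx).le) hsin)
  have hends := hanti (left_mem_Icc.2 hle) (right_mem_Icc.2 hle) hle
  simp only [F, sub_self, mul_zero, Real.sin_zero, Real.cos_zero, add_sub_cancel_left,
    mul_div_cancel₀ _ hk.ne', Real.sin_pi, Real.cos_pi] at hends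
  nlinarith [hpos c (left_mem_Icc.2 hle), hpos _ (right_mem_Icc.2 hle)]

lemma exists_eq_zero_of_sturm {w w' q : ℝ → ℝ} {c k : ℝ} (hk : 0 < k)
    (hw : ∀ x ∈ Icc c (c + Real.pi / k), HasDerivAt w (w' x) x)
    (hw' : ∀ x ∈ Icc c (c + Real.pi / k), HasDerivAt w' (-(q x * w x)) x)
    (hq : ∀ x ∈ Icc c (c + Real.pi / k), k ^ 2 ≤ q x) :
    ∃ x ∈ Icc c (c + Real.pi / k), w x = 0 := by
  obtain ⟨x, hx, hx0⟩ := exists_nonpos_of_sturm hk hw hw' hq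
  obtain ⟨y, hy, hy0⟩ := exists_nonpos_of_sturm (w := -w) (w' := -w') hk
    (fun x hx => (hw x hx).neg)
    (fun x hx => (hw' x hx).neg.congr_deriv (by simp)) hq
  exact isPreconnected_Icc.intermediate_value hx hy
    (fun x hx => (hw x hx).continuousAt.continuousWithinAt) ⟨hx0, neg_nonpos.1 hy0⟩

end RealZeros

section BesselZeros

lemma hasDerivAt_mul_reducedBesselJ_succ (ν x : ℝ) :
    HasDerivAt (fun x => x / 2 * reducedBesselJ (ν + 1) x)
      (reducedBesselJ ν x - (ν + 1 / 2) * reducedBesselJ (ν + 1) x) x := by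
  refine (((hasDerivAt_id x).div_const 2).mul (hasDerivAt_reducedBesselJ (ν + 1) x)).congr_deriv ?_
  rw [reducedBesselJ_eq_sub ν, show ν + 1 + 1 = ν + 2 by ring, id]
  ring

/-- `x ^ (ν + 1/2) * reducedBesselJ ν x`, a multiple of `√x J_ν(x)`, solves
`w'' = -(1 + (1/4 - ν²) / x²) w`, so Sturm comparison applies with `k = 1/2` for large `x`. -/
lemma exists_gt_reducedBesselJ_eq_zero (ν c : ℝ) : ∃ x > c, reducedBesselJ ν x = 0 := by
  have hb : 0 < max (c + 1) (2 * |ν| + 1) := lt_max_of_lt_right (by positivity)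
  set b := max (c + 1) (2 * |ν| + 1)
  have hpos : ∀ x ∈ Icc b (b + Real.pi / 2⁻¹), 0 < x := fun x hx => hb.trans_le hx.1
  set μ := ν + 1 / 2
  have hw : ∀ x ∈ Icc b (b + Real.pi / 2⁻¹),
      HasDerivAt (fun x => x ^ μ * reducedBesselJ ν x)
        (μ * x ^ (μ - 1) * reducedBesselJ ν x - x ^ μ * (x / 2 * reducedBesselJ (ν + 1) x)) x :=
    fun x hx => ((Real.hasDerivAt_rpow_const (.inl (hpos x hx).ne')).mul
      (hasDerivAt_reducedBesselJ ν x)).congr_deriv (by ring)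
  have hw' : ∀ x ∈ Icc b (b + Real.pi / 2⁻¹),
      HasDerivAt (fun x => μ * x ^ (μ - 1) * reducedBesselJ ν x -
          x ^ μ * (x / 2 * reducedBesselJ (ν + 1) x))
        (-((1 + (1 / 4 - ν ^ 2) / x ^ 2) * (x ^ μ * reducedBesselJ ν x))) x := fun x hx => by
    have hx := hpos x hx
    refine (((((Real.hasDerivAt_rpow_const (p := μ - 1) (.inl hx.ne')).const_mul μ).mul
      (hasDerivAt_reducedBesselJ ν x))).sub ((Real.hasDerivAt_rpow_const (.inl hx.ne')).mul
        (hasDerivAt_mul_reducedBesselJ_succ ν x))).congr_deriv ?_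
    rw [Real.rpow_sub_one hx.ne', Real.rpow_sub_one hx.ne']
    simp only [μ]
    field_simp
    ring
  have hq : ∀ x ∈ Icc b (b + Real.pi / 2⁻¹), (2⁻¹ : ℝ) ^ 2 ≤ 1 + (1 / 4 - ν ^ 2) / x ^ 2 :=
    fun x hx => by
      have hx0 := hpos x hx
      have hνx : 2 * |ν| ≤ x := by linarith [(le_max_right (c + 1) (2 * |ν| + 1)).trans hx.1]
      rw [← sub_le_iff_le_add', le_div_iff₀ (by positivity)]
      nlinarith [sq_abs ν, abs_nonneg ν]
  obtain ⟨x, hx, hx0⟩ := exists_eq_zero_of_sturm (by norm_num) hw hw' hq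
  refine ⟨x, by linarith [(le_max_left (c + 1) (2 * |ν| + 1)).trans hx.1], ?_⟩
  exact (mul_eq_zero.1 hx0).resolve_left (Real.rpow_pos_of_pos (hpos x hx) μ).ne'

lemma analyticOnNhd_reducedBesselJ (ν : ℝ) : AnalyticOnNhd ℝ (reducedBesselJ ν) univ :=
  fun _ _ => (analyticOnNhd_besselClifford ν _ (mem_univ _)).comp (by fun_prop)

variable {ν : ℝ}

lemma setOf_reducedBesselJ_mul_ne_zero_mem_codiscrete (hν : -1 < ν) (a : ℝ) :
    {s | reducedBesselJ ν (a * s) ≠ 0} ∈ codiscrete ℝ := by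
  have hana : AnalyticOnNhd ℝ (fun s => reducedBesselJ ν (a * s)) univ := fun _ _ =>
    (analyticOnNhd_reducedBesselJ ν _ (mem_univ _)).comp (by fun_prop)
  exact hana.preimage_zero_mem_codiscrete (x := 0)
    (by simpa using (reducedBesselJ_zero_pos hν).ne')

lemma countable_setOf_reducedBesselJ_mul_eq_zero (hν : -1 < ν) (a : ℝ) :
    {s | reducedBesselJ ν (a * s) = 0}.Countable :=
  (HereditarilyLindelofSpace.isLindelof _).countable_of_isDiscrete <| by
    simpa [compl_ofPred] using
      (mem_codiscrete'.1 (setOf_reducedBesselJ_mul_ne_zero_mem_codiscrete hν a)).2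

lemma eventually_reducedBesselJ_mul_ne_zero (hν : -1 < ν) (a z : ℝ) :
    ∀ᶠ s in 𝓝[≠] z, reducedBesselJ ν (a * s) ≠ 0 := by
  have h := disjoint_principal_right.1
    (mem_codiscrete.1 (setOf_reducedBesselJ_mul_ne_zero_mem_codiscrete hν a) z)
  rwa [compl_compl] at h

lemma hasDerivAt_reducedBesselJ_mul (ν a s : ℝ) :
    HasDerivAt (fun s => reducedBesselJ ν (a * s))
      (-(a * s / 2) * reducedBesselJ (ν + 1) (a * s) * a) s := by
  simpa [Function.comp_def] using
    (hasDerivAt_reducedBesselJ ν (a * s)).comp s ((hasDerivAt_id s).const_mul a)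

lemma continuous_reducedBesselJ_mul (ν a : ℝ) : Continuous fun s => reducedBesselJ ν (a * s) :=
  (continuous_reducedBesselJ ν).comp (continuous_const_mul a)

variable {a : ℝ}

lemma besselZero_succ_eq (ha : 0 < a) {k : ℕ} (hk : 0 ≤ besselZero ν a k) :
    besselZero ν a (k + 1) = sInf {s | besselZero ν a k < s ∧ reducedBesselJ ν (a * s) = 0} := by
  rw [besselZero]
  congr 1
  ext s
  exact and_congr_right fun hs => besselJ_eq_zero_iff (mul_pos ha (hk.trans_lt hs))

lemma besselZero_succ_mem_of_nonneg (hν : -1 < ν) (ha : 0 < a) {k : ℕ}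
    (hk : 0 ≤ besselZero ν a k) :
    besselZero ν a (k + 1) ∈ {s | besselZero ν a k < s ∧ reducedBesselJ ν (a * s) = 0} := by
  rw [besselZero_succ_eq ha hk]
  refine csInf_zeros_mem (continuous_reducedBesselJ_mul ν a)
    ((eventually_reducedBesselJ_mul_ne_zero hν a _).filter_mono (nhdsGT_le_nhdsNE _)) ?_
  obtain ⟨x, hx, hx0⟩ := exists_gt_reducedBesselJ_eq_zero ν (a * besselZero ν a k)
  exact ⟨x / a, (lt_div_iff₀' ha).2 hx, by rwa [mul_div_cancel₀ _ ha.ne']⟩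

lemma besselZero_nonneg (hν : -1 < ν) (ha : 0 < a) : ∀ k, 0 ≤ besselZero ν a k
  | 0 => le_rfl
  | k + 1 => (besselZero_nonneg hν ha k).trans
      (besselZero_succ_mem_of_nonneg hν ha (besselZero_nonneg hν ha k)).1.le

lemma strictMono_besselZero (hν : -1 < ν) (ha : 0 < a) : StrictMono (besselZero ν a) :=
  strictMono_nat_of_lt_succ fun k =>
    (besselZero_succ_mem_of_nonneg hν ha (besselZero_nonneg hν ha k)).1

lemma reducedBesselJ_mul_besselZero_succ (hν : -1 < ν) (ha : 0 < a) (k : ℕ) :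
    reducedBesselJ ν (a * besselZero ν a (k + 1)) = 0 :=
  (besselZero_succ_mem_of_nonneg hν ha (besselZero_nonneg hν ha k)).2

lemma reducedBesselJ_mul_ne_zero_of_mem_Ioo (hν : -1 < ν) (ha : 0 < a) {k : ℕ} {s : ℝ}
    (hs : s ∈ Ioo (besselZero ν a k) (besselZero ν a (k + 1))) :
    reducedBesselJ ν (a * s) ≠ 0 := by
  intro h
  rw [besselZero_succ_eq ha (besselZero_nonneg hν ha k)] at hs
  exact notMem_of_lt_csInf hs.2 ⟨_, fun t ht => ht.1.le⟩ ⟨hs.1, h⟩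

lemma tendsto_besselZero_atTop (hν : -1 < ν) (ha : 0 < a) :
    Tendsto (besselZero ν a) atTop atTop := by
  have hmono := strictMono_besselZero hν ha
  refine (tendsto_atTop_of_monotone hmono.monotone).resolve_right ?_
  rintro ⟨l, hl⟩
  have hne : Tendsto (besselZero ν a) atTop (𝓝[≠] l) :=
    tendsto_nhdsWithin_iff.2 ⟨hl, .of_forall fun k =>
      ((hmono k.lt_succ_self).trans_le (hmono.monotone.ge_of_tendsto hl _)).ne⟩
  obtain ⟨k, hk⟩ := (((tendsto_add_atTop_iff_nat 1).2 hne).eventually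
    (eventually_reducedBesselJ_mul_ne_zero hν a l)).exists
  exact hk (reducedBesselJ_mul_besselZero_succ hν ha k)

lemma exists_mem_Ioc_besselZero (hν : -1 < ν) (ha : 0 < a) {s : ℝ} (hs : 0 < s) :
    ∃ k, s ∈ Ioc (besselZero ν a k) (besselZero ν a (k + 1)) := by
  have hunion : ⋃ k, Ioc (besselZero ν a k) (besselZero ν a (Order.succ k)) = Ioi 0 :=
    iUnion_Ioc_map_succ_eq_Ioi (besselZero_nonneg hν ha)
      (not_bddAbove_of_tendsto_atTop (tendsto_besselZero_atTop hν ha))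
  exact mem_iUnion.1 (hunion ▸ hs)

lemma neg_one_pow_mul_reducedBesselJ_pos (hν : -1 < ν) (ha : 0 < a) (k : ℕ) :
    ∀ s ∈ Ioo (besselZero ν a k) (besselZero ν a (k + 1)),
      0 < (-1) ^ k * reducedBesselJ ν (a * s) := by
  have hmono := strictMono_besselZero hν ha
  induction k with
  | zero =>
    intro s hs
    have hne : ∀ t ∈ Ico 0 (besselZero ν a 1), reducedBesselJ ν (a * t) ≠ 0 := by
      rintro t ⟨ht, ht'⟩
      rcases ht.eq_or_lt with rfl | ht
      · simpa using (reducedBesselJ_zero_pos hν).ne'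
      · exact reducedBesselJ_mul_ne_zero_of_mem_Ioo hν ha (k := 0) ⟨ht, ht'⟩
    simpa using pos_of_isPreconnected_of_ne_zero isPreconnected_Ico
      (continuous_reducedBesselJ_mul ν a).continuousOn hne ⟨le_rfl, hmono zero_lt_one⟩
      (Ioo_subset_Ico_self hs) (by simpa using reducedBesselJ_zero_pos hν)
  | succ k ih =>
    have hz := (besselZero_nonneg hν ha k).trans_lt (hmono k.lt_succ_self)
    have hzero := reducedBesselJ_mul_besselZero_succ hν ha k
    have hderiv := (hasDerivAt_reducedBesselJ_mul ν a (besselZero ν a (k + 1))).const_mul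
      ((-1 : ℝ) ^ k)
    have hsimple := reducedBesselJ_succ_ne_zero (mul_pos ha hz).ne' hzero
    have hneg := neg_on_Ioo_of_simple_zero
      ((continuous_reducedBesselJ_mul ν a).const_mul ((-1 : ℝ) ^ k))
      (hmono k.lt_succ_self) (hmono (k + 1).lt_succ_self) hderiv (by simp [hzero])
      (by simp [hsimple, ha.ne', hz.ne']) ih
      (fun s hs => mul_ne_zero (by simp) (reducedBesselJ_mul_ne_zero_of_mem_Ioo hν ha hs))
    intro s hs
    rw [pow_succ, mul_neg_one, neg_mul]
    exact neg_pos.2 (hneg s hs)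

end BesselZeros

section SignPattern

variable {d : ℕ} {a : ℝ} {β : ℝ → ℝ}

lemma hasBesselSignPattern_iff_alternating :
    HasBesselSignPattern d a β ↔
      ∀ k : ℕ, ∀ s ∈ Icc (besselZero ((d : ℝ) / 2) a k) (besselZero ((d : ℝ) / 2) a (k + 1)),
        0 ≤ (-1) ^ k * β s := by
  have heven : ∀ k : ℕ, (-1 : ℝ) ^ (2 * k) = 1 := fun k => (even_two_mul k).neg_one_pow
  have hodd : ∀ k : ℕ, (-1 : ℝ) ^ (2 * k + 1) = -1 := fun k => (odd_two_mul_add_one k).neg_one_pow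
  constructor
  · rintro ⟨hzero, hpos⟩ k s hs
    rcases Nat.even_or_odd' k with ⟨m, rfl | rfl⟩
    · rw [heven, one_mul]
      rcases m.eq_zero_or_pos with rfl | hm
      · exact hzero s hs
      · exact (hpos m hm).2 s hs
    · rw [hodd, neg_one_mul]
      exact neg_nonneg.2 ((hpos (m + 1) m.succ_pos).1 s hs)
  · intro h
    refine ⟨fun s hs => by simpa using h 0 s hs, fun k hk => ⟨fun s hs => ?_, fun s hs => ?_⟩⟩
    · obtain ⟨m, rfl⟩ := Nat.exists_eq_add_of_le' hk
      simpa [hodd] using h (2 * m + 1) s hs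
    · simpa [heven] using h (2 * k) s hs

lemma mul_reducedBesselJ_nonneg_iff (ha : 0 < a) {k : ℕ} {s : ℝ}
    (hs : s ∈ Ioo (besselZero ((d : ℝ) / 2) a k) (besselZero ((d : ℝ) / 2) a (k + 1))) :
    0 ≤ β s * reducedBesselJ ((d : ℝ) / 2) (a * s) ↔ 0 ≤ (-1) ^ k * β s := by
  have hν : -1 < (d : ℝ) / 2 := by linarith [show (0 : ℝ) ≤ d / 2 by positivity]
  have hsq : (-1 : ℝ) ^ k * (-1) ^ k = 1 := by rw [← mul_pow]; simp
  rw [← mul_nonneg_iff_of_pos_right (b := (-1) ^ k * β s)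
    (neg_one_pow_mul_reducedBesselJ_pos hν ha k s hs), mul_mul_mul_comm, hsq, one_mul]

lemma hasBesselSignPattern_iff (ha : 0 < a) (hβ : ContinuousOn β (Ici 0)) :
    HasBesselSignPattern d a β ↔
      ∀ s, 0 ≤ s → 0 ≤ β s * reducedBesselJ ((d : ℝ) / 2) (a * s) := by
  have hν : -1 < (d : ℝ) / 2 := by linarith [show (0 : ℝ) ≤ d / 2 by positivity]
  have hmono := strictMono_besselZero hν ha
  rw [hasBesselSignPattern_iff_alternating]
  constructor
  · intro h s hs
    rcases hs.eq_or_lt with rfl | hs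
    · rw [mul_zero]
      exact mul_nonneg (by simpa using h 0 0 ⟨le_rfl, (hmono zero_lt_one).le⟩)
        (reducedBesselJ_zero_pos hν).le
    · obtain ⟨k, hk, hk'⟩ := exists_mem_Ioc_besselZero hν ha hs
      rcases hk'.eq_or_lt with rfl | hk'
      · rw [reducedBesselJ_mul_besselZero_succ hν ha, mul_zero]
      · exact (mul_reducedBesselJ_nonneg_iff ha ⟨hk, hk'⟩).2 (h k s ⟨hk.le, hk'.le⟩)
  · intro h k
    have hsub : Icc (besselZero ((d : ℝ) / 2) a k) (besselZero ((d : ℝ) / 2) a (k + 1)) ⊆ Ici 0 :=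
      fun s hs => (besselZero_nonneg hν ha k).trans hs.1
    rw [← closure_Ioo (hmono k.lt_succ_self).ne] at hsub ⊢
    intro s hs
    refine ContinuousWithinAt.closure_le hs continuousWithinAt_const
      (continuousWithinAt_const.mul ((hβ s (hsub hs)).mono (subset_closure.trans hsub)))
      fun t ht => ?_
    exact (mul_reducedBesselJ_nonneg_iff ha ht).1 (h t (hsub (subset_closure ht)))

end SignPattern

section PolarCoordinates

variable {E G : Type*} [NormedAddCommGroup E] [NormedSpace ℝ E] [FiniteDimensional ℝ E]
  [MeasurableSpace E] [BorelSpace E] [Nontrivial E] (μ : Measure E) [μ.IsAddHaarMeasure]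
  [NormedAddCommGroup G]

lemma integral_volumeIoiPow [NormedSpace ℝ G] (n : ℕ) (g : ℝ → G) :
    ∫ r : Ioi (0 : ℝ), g r ∂Measure.volumeIoiPow n = ∫ r in Ioi (0 : ℝ), r ^ n • g r := by
  simp only [Measure.volumeIoiPow, ENNReal.ofReal]
  rw [integral_withDensity_eq_integral_smul (measurable_subtype_coe.pow_const n).real_toNNReal,
    integral_subtype_comap measurableSet_Ioi fun r : ℝ => Real.toNNReal (r ^ n) • g r]
  refine setIntegral_congr_fun measurableSet_Ioi fun r hr => ?_
  simp only [NNReal.smul_def, Real.coe_toNNReal _ (pow_nonneg (le_of_lt hr) n)]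

lemma integral_polar [NormedSpace ℝ G] {F : E → G} (hF : Integrable F μ) :
    ∫ x, F x ∂μ = ∫ r in Ioi (0 : ℝ), r ^ (Module.finrank ℝ E - 1) •
      ∫ θ : Metric.sphere (0 : E) 1, F (r • (θ : E)) ∂μ.toSphere := by
  have hmp := μ.measurePreserving_homeomorphUnitSphereProd
  have hemb := (homeomorphUnitSphereProd E).measurableEmbedding
  let K : Metric.sphere (0 : E) 1 × Ioi (0 : ℝ) → G := fun p => F ((p.2 : ℝ) • (p.1 : E))
  have hK : ∀ x : ({0}ᶜ : Set E), K (homeomorphUnitSphereProd E x) = F x := fun x => by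
    simp only [K, homeomorphUnitSphereProd_apply_snd_coe, homeomorphUnitSphereProd_apply_fst_coe,
      smul_smul, mul_inv_cancel₀ (norm_ne_zero_iff.2 x.2), one_smul]
  have hKint : Integrable K (μ.toSphere.prod (.volumeIoiPow (Module.finrank ℝ E - 1))) := by
    rw [← hmp.integrable_comp_emb hemb,
      show K ∘ homeomorphUnitSphereProd E = F ∘ (↑) from funext hK,
      ← integrableOn_iff_comap_subtypeVal (measurableSet_singleton _).compl]
    exact hF.integrableOn
  rw [← integral_volumeIoiPow _ fun r => ∫ θ : Metric.sphere (0 : E) 1, F (r • (θ : E)) ∂μ.toSphere,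
    ← integral_prod_symm K hKint, ← hmp.integral_comp hemb]
  simp only [hK]
  rw [integral_subtype_comap (measurableSet_singleton _).compl F, restrict_compl_singleton]

lemma map_val_volumeIoiPow (d : ℕ) :
    (Measure.volumeIoiPow (d - 1)).map ((↑) : Ioi (0 : ℝ) → ℝ) = radialMeasure d := by
  ext s hs
  rw [Measure.map_apply measurable_subtype_coe hs, Measure.volumeIoiPow,
    withDensity_apply _ (measurable_subtype_coe hs), radialMeasure, withDensity_apply _ hs,
    setLIntegral_subtype measurableSet_Ioi _ fun r : ℝ => .ofReal (r ^ (d - 1)),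
    Measure.restrict_restrict hs, Subtype.image_preimage_coe, inter_comm]
  exact setLIntegral_congr ((ae_eq_refl s).inter Ioi_ae_eq_Ici)

lemma map_norm_addHaar :
    μ.map norm = μ.toSphere univ • radialMeasure (Module.finrank ℝ E) := by
  have hmp := μ.measurePreserving_homeomorphUnitSphereProd
  have hμ : (μ.comap ((↑) : ({0}ᶜ : Set E) → E)).map (↑) = μ := by
    rw [map_comap_subtype_coe (measurableSet_singleton _).compl, restrict_compl_singleton]
  have hnorm : (norm : E → ℝ) ∘ ((↑) : ({0}ᶜ : Set E) → E) =
      (↑) ∘ Prod.snd ∘ homeomorphUnitSphereProd E := by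
    ext x
    simp
  conv_lhs => rw [← hμ]
  rw [Measure.map_map measurable_norm measurable_subtype_coe, hnorm,
    ← Measure.map_map measurable_subtype_coe (measurable_snd.comp hmp.measurable),
    ← Measure.map_map measurable_snd hmp.measurable, hmp.map_eq, Measure.map_snd_prod,
    Measure.map_smul, map_val_volumeIoiPow]

lemma toSphere_univ_ne_zero : μ.toSphere univ ≠ 0 :=
  Measure.measure_univ_ne_zero.2 μ.toSphere_ne_zero

lemma quasiMeasurePreserving_norm :
    Measure.QuasiMeasurePreserving norm μ (radialMeasure (Module.finrank ℝ E)) :=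
  ⟨measurable_norm, map_norm_addHaar μ ▸ Measure.smul_absolutelyContinuous⟩

lemma memLp_smul_measure_iff {X : Type*} [MeasurableSpace X] {ρ : Measure X} {f : X → G}
    {p c : ℝ≥0∞} (hc : c ≠ 0) (hc' : c ≠ ∞) : MemLp f p (c • ρ) ↔ MemLp f p ρ := by
  refine ⟨fun h => ?_, fun h => h.smul_measure hc'⟩
  have hscaled := h.smul_measure (ENNReal.inv_ne_top.2 hc)
  rwa [smul_smul, ENNReal.inv_mul_cancel hc hc', one_smul] at hscaled

variable {f : ℝ → G} {p : ℝ≥0∞}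

lemma eLpNorm_comp_norm (hp : p ≠ ∞)
    (hf : AEStronglyMeasurable f (radialMeasure (Module.finrank ℝ E))) :
    eLpNorm (fun x => f ‖x‖) p μ =
      μ.toSphere univ ^ (1 / p).toReal * eLpNorm f p (radialMeasure (Module.finrank ℝ E)) := by
  rw [← smul_eq_mul, ← eLpNorm_smul_measure_of_ne_top hp, ← map_norm_addHaar, eLpNorm_map_measure
    (map_norm_addHaar μ ▸ hf.smul_measure _) measurable_norm.aemeasurable]
  rfl

lemma memLp_comp_norm_iff (hf : AEStronglyMeasurable f (radialMeasure (Module.finrank ℝ E))) :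
    MemLp (fun x => f ‖x‖) p μ ↔ MemLp f p (radialMeasure (Module.finrank ℝ E)) := by
  rw [← memLp_smul_measure_iff (ρ := radialMeasure _) (toSphere_univ_ne_zero μ)
      (measure_ne_top μ.toSphere univ), ← map_norm_addHaar,
    memLp_map_measure_iff (map_norm_addHaar μ ▸ hf.smul_measure _) measurable_norm.aemeasurable,
    Function.comp_def]

end PolarCoordinates

section GaussianMoments

lemma gamma_nat_add_half (k : ℕ) :
    Real.Gamma (k + 1 / 2) = (2 * k).factorial / (4 ^ k * k.factorial) * √Real.pi := by
  have h := Real.Gamma_mul_Gamma_add_half (k + 1 / 2)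
  rw [show (k : ℝ) + 1 / 2 + 1 / 2 = k + 1 by ring, Real.Gamma_nat_eq_factorial,
    show 2 * ((k : ℝ) + 1 / 2) = (2 * k : ℕ) + 1 by push_cast; ring, Real.Gamma_nat_eq_factorial,
    show 1 - (((2 * k : ℕ) : ℝ) + 1) = -(2 * k : ℕ) by ring, Real.rpow_neg (by norm_num),
    Real.rpow_natCast, pow_mul] at h
  norm_num at h
  field_simp
  field_simp at h
  linear_combination h

lemma integral_pow_mul_exp_neg_sq (k : ℕ) :
    ∫ t : ℝ, t ^ (2 * k) * Real.exp (-t ^ 2) =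
      (2 * k).factorial / (4 ^ k * k.factorial) * √Real.pi := by
  have heven := integral_comp_abs (f := fun t : ℝ => t ^ (2 * k) * Real.exp (-t ^ 2))
  have hgamma := integral_rpow_mul_exp_neg_rpow (p := 2) (q := (2 * k : ℕ)) (by norm_num)
    (by linarith [(2 * k).cast_nonneg (α := ℝ)])
  simp only [Real.rpow_natCast, Real.rpow_two] at hgamma
  simp only [pow_mul, sq_abs] at heven hgamma ⊢
  rw [heven, hgamma, ← gamma_nat_add_half]
  push_cast
  ring_nf

lemma integrable_pow_mul_exp_neg_sq (k : ℕ) :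
    Integrable fun t : ℝ => t ^ (2 * k) * Real.exp (-t ^ 2) := by
  by_contra h
  have hval := integral_pow_mul_exp_neg_sq k
  rw [integral_undef h] at hval
  exact (by positivity : (2 * k).factorial / (4 ^ k * k.factorial) * √Real.pi ≠ 0) hval.symm

section Coordinates

variable {ι : Type*} [Fintype ι] (i : ι) (k : ℕ)

lemma coord_pow_mul_exp_neg_norm_sq [DecidableEq ι] (x : EuclideanSpace ℝ ι) :
    x i ^ (2 * k) * Real.exp (-‖x‖ ^ 2) =
      ∏ j, (x j ^ (2 * if j = i then k else 0) * Real.exp (-x j ^ 2)) := by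
  rw [Finset.prod_mul_distrib, ← Real.exp_sum, EuclideanSpace.norm_sq_eq, Finset.sum_neg_distrib,
    Finset.prod_eq_single i (fun j _ hj => by simp [hj]) (by simp)]
  simp

lemma integrable_coord_pow_mul_exp_neg_norm_sq :
    Integrable fun x : EuclideanSpace ℝ ι => x i ^ (2 * k) * Real.exp (-‖x‖ ^ 2) := by
  classical
  simp_rw [coord_pow_mul_exp_neg_norm_sq]
  rw [← (EuclideanSpace.volume_preserving_symm_measurableEquiv_toLp ι).symm.integrable_comp_emb
    (MeasurableEquiv.measurableEmbedding _)]
  exact Integrable.fintype_prod (f := fun (j : ι) (t : ℝ) =>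
    t ^ (2 * if j = i then k else 0) * Real.exp (-t ^ 2)) fun j => integrable_pow_mul_exp_neg_sq _

lemma integral_coord_pow_mul_exp_neg_norm_sq :
    ∫ x : EuclideanSpace ℝ ι, x i ^ (2 * k) * Real.exp (-‖x‖ ^ 2) =
      (2 * k).factorial / (4 ^ k * k.factorial) * √Real.pi ^ Fintype.card ι := by
  classical
  simp_rw [coord_pow_mul_exp_neg_norm_sq]
  rw [← (EuclideanSpace.volume_preserving_symm_measurableEquiv_toLp ι).symm.integral_comp
    (MeasurableEquiv.measurableEmbedding _)]
  refine (integral_fintype_prod_volume_eq_prod fun (j : ι) (t : ℝ) =>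
    t ^ (2 * if j = i then k else 0) * Real.exp (-t ^ 2)).trans ?_
  simp_rw [integral_pow_mul_exp_neg_sq, Finset.prod_mul_distrib]
  rw [Finset.prod_eq_single i (fun j _ hj => by simp [hj]) (by simp)]
  simp

end Coordinates

end GaussianMoments

section SphereTransform

variable {E : Type*} [NormedAddCommGroup E] [InnerProductSpace ℝ E] [FiniteDimensional ℝ E]

lemma exists_orthonormalBasis_norm_smul_eq [Nontrivial E] (ξ : E) :
    ∃ (u : Finset E) (b : OrthonormalBasis u ℝ E) (i : u), ‖ξ‖ • b i = ξ := by
  obtain ⟨v, hv, hvξ⟩ : ∃ v : E, ‖v‖ = 1 ∧ ‖ξ‖ • v = ξ := by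
    rcases eq_or_ne ξ 0 with rfl | hξ
    · obtain ⟨v, hv⟩ := exists_norm_eq E zero_le_one
      exact ⟨v, hv, by simp⟩
    · exact ⟨‖ξ‖⁻¹ • ξ, norm_smul_inv_norm hξ, smul_inv_smul₀ (norm_ne_zero_iff.2 hξ) ξ⟩
  have hon : Orthonormal ℝ ((↑) : ({v} : Set E) → E) := by
    simp [orthonormal_subsingleton_iff, hv]
  obtain ⟨u, b, hvu, hb⟩ := hon.exists_orthonormalBasis_extension
  exact ⟨u, b, ⟨v, hvu rfl⟩, by simp [hb, hvξ]⟩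

variable [MeasurableSpace E] [BorelSpace E] [Nontrivial E]

lemma integrable_and_integral_inner_pow_mul_exp_neg_norm_sq (ξ : E) (k : ℕ) :
    Integrable (fun x : E => inner ℝ x ξ ^ (2 * k) * Real.exp (-‖x‖ ^ 2)) ∧
    ∫ x : E, inner ℝ x ξ ^ (2 * k) * Real.exp (-‖x‖ ^ 2) =
      ‖ξ‖ ^ (2 * k) * ((2 * k).factorial / (4 ^ k * k.factorial) *
        √Real.pi ^ Module.finrank ℝ E) := by
  obtain ⟨u, b, i, hξ⟩ := exists_orthonormalBasis_norm_smul_eq ξ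
  have hcoord : (fun x : E => inner ℝ x ξ ^ (2 * k) * Real.exp (-‖x‖ ^ 2)) = fun x =>
      ‖ξ‖ ^ (2 * k) * (b.repr x i ^ (2 * k) * Real.exp (-‖b.repr x‖ ^ 2)) := by
    ext x
    conv_lhs => rw [← hξ]
    rw [real_inner_smul_right, real_inner_comm, b.repr_apply_apply, b.repr.norm_map, mul_pow,
      mul_assoc]
  have hemb := b.repr.toHomeomorph.measurableEmbedding
  rw [hcoord]
  refine ⟨.const_mul ((b.measurePreserving_repr.integrable_comp_emb hemb).2
    (integrable_coord_pow_mul_exp_neg_norm_sq i k)) _, ?_⟩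
  rw [integral_const_mul, b.measurePreserving_repr.integral_comp hemb fun y =>
      y i ^ (2 * k) * Real.exp (-‖y‖ ^ 2), integral_coord_pow_mul_exp_neg_norm_sq,
    Module.finrank_eq_card_basis b.toBasis]

lemma integral_sphere_inner_pow (ξ : E) (k : ℕ) :
    ∫ θ : Metric.sphere (0 : E) 1, inner ℝ (θ : E) ξ ^ (2 * k) ∂volume.toSphere =
      (2 * k).factorial * (2 * Real.pi ^ ((Module.finrank ℝ E : ℝ) / 2) *
        (besselCliffordCoeff ((Module.finrank ℝ E : ℝ) / 2 - 1) k * (‖ξ‖ ^ 2 / 4) ^ k)) := by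
  obtain ⟨hint, hgauss⟩ := integrable_and_integral_inner_pow_mul_exp_neg_norm_sq ξ k
  have hn : 0 < Module.finrank ℝ E := Module.finrank_pos
  set n := Module.finrank ℝ E
  have hn' : (0 : ℝ) < n := Nat.cast_pos.2 hn
  set M := ∫ θ : Metric.sphere (0 : E) 1, inner ℝ (θ : E) ξ ^ (2 * k) ∂volume.toSphere
  have hradial : ∀ r ∈ Ioi (0 : ℝ), r ^ (n - 1) • ∫ θ : Metric.sphere (0 : E) 1,
      inner ℝ (r • (θ : E)) ξ ^ (2 * k) * Real.exp (-‖r • (θ : E)‖ ^ 2) ∂volume.toSphere =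
      M * (r ^ ((n - 1 + 2 * k : ℕ) : ℝ) * Real.exp (-r ^ (2 : ℝ))) := by
    intro r _
    simp_rw [real_inner_smul_left, norm_smul, norm_eq_of_mem_sphere, mul_one, mul_pow,
      mul_right_comm _ _ (Real.exp _)]
    rw [integral_const_mul, Real.norm_eq_abs, sq_abs, Real.rpow_two, Real.rpow_natCast, pow_add,
      smul_eq_mul]
    ring
  rw [integral_polar _ hint, setIntegral_congr_fun measurableSet_Ioi hradial, integral_const_mul,
    integral_rpow_mul_exp_neg_rpow (by norm_num)
      (by linarith [(n - 1 + 2 * k).cast_nonneg (α := ℝ)]),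
    show (((n - 1 + 2 * k : ℕ) : ℝ) + 1) / 2 = k + n / 2 by push_cast [Nat.cast_sub hn]; ring,
    Real.sqrt_eq_rpow, ← Real.rpow_mul_natCast Real.pi_pos.le, one_div_mul_eq_div] at hgauss
  have hΓ := (Real.Gamma_pos_of_pos (by positivity : 0 < (k : ℝ) + n / 2)).ne'
  rw [besselCliffordCoeff, show (k : ℝ) + (n / 2 - 1) + 1 = k + n / 2 by ring, div_pow, ← pow_mul]
  field_simp [hΓ] at hgauss ⊢
  linear_combination hgauss

lemma integral_sphere_cos (ξ : E) :
    ∫ θ : Metric.sphere (0 : E) 1, Real.cos (inner ℝ (θ : E) ξ) ∂volume.toSphere =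
      2 * Real.pi ^ ((Module.finrank ℝ E : ℝ) / 2) *
        reducedBesselJ ((Module.finrank ℝ E : ℝ) / 2 - 1) ‖ξ‖ := by
  have hbound (k : ℕ) (θ : Metric.sphere (0 : E) 1) :
      ‖(-1) ^ k * inner ℝ (θ : E) ξ ^ (2 * k) / (2 * k).factorial‖ ≤
        ‖ξ‖ ^ (2 * k) / (2 * k).factorial := by
    simp only [norm_div, norm_mul, norm_pow, norm_neg, norm_one, one_pow, one_mul,
      RCLike.norm_natCast]
    gcongr
    simpa [norm_eq_of_mem_sphere θ] using norm_inner_le_norm (𝕜 := ℝ) (θ : E) ξ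
  have hsummable : Summable fun k : ℕ => ‖ξ‖ ^ (2 * k) / (2 * k).factorial :=
    (Real.summable_pow_div_factorial ‖ξ‖).comp_injective (i := fun k : ℕ => 2 * k)
      (mul_right_injective₀ two_ne_zero)
  have hcont (k : ℕ) : Continuous fun θ : Metric.sphere (0 : E) 1 =>
      (-1) ^ k * inner ℝ (θ : E) ξ ^ (2 * k) / (2 * k).factorial := by fun_prop
  have hcos : HasSum (fun k : ℕ => ∫ θ : Metric.sphere (0 : E) 1,
      (-1) ^ k * inner ℝ (θ : E) ξ ^ (2 * k) / (2 * k).factorial ∂volume.toSphere)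
      (∫ θ : Metric.sphere (0 : E) 1, Real.cos (inner ℝ (θ : E) ξ) ∂volume.toSphere) :=
    hasSum_integral_of_dominated_convergence
      (fun k _ => ‖ξ‖ ^ (2 * k) / (2 * k).factorial) (fun k => (hcont k).aestronglyMeasurable)
      (fun k => ae_of_all _ (hbound k)) (ae_of_all _ fun _ => hsummable)
      (integrable_const _) (ae_of_all _ fun _ => Real.hasSum_cos _)
  have hmoment (k : ℕ) : ∫ θ : Metric.sphere (0 : E) 1,
      (-1) ^ k * inner ℝ (θ : E) ξ ^ (2 * k) / (2 * k).factorial ∂volume.toSphere =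
      2 * Real.pi ^ ((Module.finrank ℝ E : ℝ) / 2) *
        (besselCliffordCoeff ((Module.finrank ℝ E : ℝ) / 2 - 1) k * (-(‖ξ‖ ^ 2 / 4)) ^ k) := by
    rw [integral_div, integral_const_mul, integral_sphere_inner_pow, neg_pow (‖ξ‖ ^ 2 / 4)]
    field_simp
  simp_rw [hmoment] at hcos
  exact hcos.unique ((hasSum_besselClifford _ _).mul_left _)

lemma integral_radial_mul_cos {f : ℝ → ℝ} (hf : Integrable fun x : E => f ‖x‖) (ξ : E) :
    ∫ x : E, f ‖x‖ * Real.cos (inner ℝ x ξ) =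
      2 * Real.pi ^ ((Module.finrank ℝ E : ℝ) / 2) * ∫ r in Ioi (0 : ℝ),
        f r * r ^ (Module.finrank ℝ E - 1) *
          reducedBesselJ ((Module.finrank ℝ E : ℝ) / 2 - 1) (r * ‖ξ‖) := by
  have hint : Integrable fun x : E => f ‖x‖ * Real.cos (inner ℝ x ξ) :=
    hf.mul_bdd (c := 1) (by fun_prop : Continuous _).aestronglyMeasurable
      (.of_forall fun x => Real.abs_cos_le_one _)
  rw [integral_polar _ hint, ← integral_const_mul]
  refine setIntegral_congr_fun measurableSet_Ioi fun r (hr : 0 < r) => ?_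
  simp_rw [real_inner_smul_left, ← real_inner_smul_right, norm_smul, norm_eq_of_mem_sphere, mul_one,
    Real.norm_of_nonneg hr.le]
  rw [integral_const_mul, integral_sphere_cos, norm_smul, Real.norm_of_nonneg hr.le, smul_eq_mul]
  ring

end SphereTransform

lemma integral_pow_mul_reducedBesselJ {n : ℕ} (hn : n ≠ 0) {a : ℝ} (ha : 0 ≤ a) (s : ℝ) :
    ∫ r in Ioc 0 a, r ^ (n - 1) * reducedBesselJ ((n : ℝ) / 2 - 1) (r * s) =
      a ^ n / 2 * reducedBesselJ ((n : ℝ) / 2) (a * s) := by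
  rw [← intervalIntegral.integral_of_le ha]
  have hderiv (r : ℝ) : HasDerivAt (fun r => r ^ n / 2 * reducedBesselJ ((n : ℝ) / 2) (r * s))
      (r ^ (n - 1) * reducedBesselJ ((n : ℝ) / 2 - 1) (r * s)) r := by
    have hcomp := (hasDerivAt_reducedBesselJ ((n : ℝ) / 2) (r * s)).comp r
      ((hasDerivAt_id r).mul_const s)
    refine (((hasDerivAt_pow n r).div_const 2).mul hcomp).congr_deriv ?_
    have hrec := reducedBesselJ_eq_sub ((n : ℝ) / 2 - 1) (r * s)
    have hpow : r ^ n = r ^ (n - 1) * r := by rw [← pow_succ, Nat.sub_add_cancel (by omega)]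
    rw [show (n : ℝ) / 2 - 1 + 1 = n / 2 by ring, show (n : ℝ) / 2 - 1 + 2 = n / 2 + 1 by ring]
      at hrec
    rw [hrec, hpow]
    simp only [id_eq, Function.comp_apply]
    ring
  have hcont : Continuous fun r : ℝ => r ^ (n - 1) * reducedBesselJ ((n : ℝ) / 2 - 1) (r * s) :=
    (continuous_pow _).mul ((continuous_reducedBesselJ _).comp (continuous_mul_const s))
  rw [intervalIntegral.integral_eq_sub_of_hasDerivAt (fun r _ => hderiv r)
    (hcont.intervalIntegrable _ _)]
  simp [hn]

lemma setIntegral_closedBall_cos {E : Type*} [NormedAddCommGroup E] [InnerProductSpace ℝ E]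
    [FiniteDimensional ℝ E] [MeasurableSpace E] [BorelSpace E] [Nontrivial E] {a : ℝ} (ha : 0 ≤ a)
    (ξ : E) :
    ∫ x in Metric.closedBall (0 : E) a, Real.cos (inner ℝ x ξ) =
      Real.pi ^ ((Module.finrank ℝ E : ℝ) / 2) * a ^ Module.finrank ℝ E *
        reducedBesselJ ((Module.finrank ℝ E : ℝ) / 2) (a * ‖ξ‖) := by
  have hball : (fun x : E => (Iic a).indicator (1 : ℝ → ℝ) ‖x‖) =
      (Metric.closedBall 0 a).indicator 1 := by
    ext x
    simp [indicator]
  have hint : Integrable fun x : E => (Iic a).indicator (1 : ℝ → ℝ) ‖x‖ := by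
    rw [hball, integrable_indicator_iff measurableSet_closedBall]
    exact integrableOn_const measure_closedBall_lt_top.ne
  have hindicator (r : ℝ) : (Iic a).indicator (1 : ℝ → ℝ) r * r ^ (Module.finrank ℝ E - 1) *
      reducedBesselJ ((Module.finrank ℝ E : ℝ) / 2 - 1) (r * ‖ξ‖) = (Iic a).indicator (fun r =>
        r ^ (Module.finrank ℝ E - 1) *
          reducedBesselJ ((Module.finrank ℝ E : ℝ) / 2 - 1) (r * ‖ξ‖)) r := by
    by_cases h : r ≤ a <;> simp [h]
  have hfourier := integral_radial_mul_cos hint ξ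
  simp only [congrFun hball] at hfourier
  simp only [hindicator] at hfourier
  rw [setIntegral_indicator measurableSet_Iic, Ioi_inter_Iic,
    integral_pow_mul_reducedBesselJ Module.finrank_pos.ne' ha] at hfourier
  rw [← integral_indicator measurableSet_closedBall]
  refine Eq.trans (integral_congr_ae (.of_forall fun x => ?_)) (hfourier.trans (by ring))
  by_cases h : ‖x‖ ≤ a <;> simp [h]

section Fourier

variable {V : Type*} [NormedAddCommGroup V] [InnerProductSpace ℝ V] [FiniteDimensional ℝ V]
  [MeasurableSpace V] [BorelSpace V]

lemma continuous_fourier {f : V → ℂ} (hf : Integrable f) : Continuous (𝓕 f) :=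
  VectorFourier.fourierIntegral_continuous Real.continuous_fourierChar
    (L := innerₗ V) continuous_inner hf

lemma fourier_congr {f g : V → ℂ} (h : f =ᵐ[volume] g) : 𝓕 f = 𝓕 g :=
  funext (Real.fourier_congr_ae h)

lemma fourier_zero_fun : 𝓕 (0 : V → ℂ) = 0 := by
  ext ξ
  simp [Real.fourier_eq]

lemma fourier_add_fun {f g : V → ℂ} (hf : Integrable f) (hg : Integrable g) :
    𝓕 (f + g) = 𝓕 f + 𝓕 g :=
  VectorFourier.fourierIntegral_add Real.continuous_fourierChar
    (L := innerₗ V) continuous_inner hf hg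

lemma fourier_const_smul_fun (c : ℂ) (f : V → ℂ) : 𝓕 (c • f) = c • 𝓕 f :=
  VectorFourier.fourierIntegral_const_smul 𝐞 volume (innerₗ V) f c

lemma integral_smul_fourier_eq_flip {φ f : V → ℂ} (hφ : Integrable φ) (hf : Integrable f) :
    ∫ x, φ x • 𝓕 f x = ∫ x, 𝓕 φ x • f x := by
  have h := VectorFourier.integral_fourierIntegral_smul_eq_flip (μ := (volume : Measure V))
    (ν := (volume : Measure V)) (L := innerₗ V) Real.continuous_fourierChar continuous_inner hφ hf
  rw [flip_innerₗ] at h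
  exact h.symm

lemma ae_eq_fourier_of_forall_schwartz {F f : V → ℂ} (hF : MemLp F 2) (hf : Integrable f)
    (h : ∀ φ : SchwartzMap V ℂ, ∫ x, φ x • F x = ∫ x, 𝓕 (φ : V → ℂ) x • f x) :
    F =ᵐ[volume] 𝓕 f := by
  refine ae_eq_of_integral_contDiff_smul_eq (hF.locallyIntegrable (by norm_num))
    (continuous_fourier hf).locallyIntegrable fun ψ hψ hψc => ?_
  have hcompact : HasCompactSupport (Complex.ofRealCLM ∘ ψ) := hψc.comp_left rfl
  have hsmooth : ContDiff ℝ (⊤ : ℕ∞) (Complex.ofRealCLM ∘ ψ) := Complex.ofRealCLM.contDiff.comp hψ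
  let φ : SchwartzMap V ℂ := hcompact.toSchwartzMap hsmooth
  simpa [φ] using (h φ).trans (integral_smul_fourier_eq_flip φ.integrable hf).symm

lemma fourier_toLp_ae_eq {f : V → ℂ} (h1 : Integrable f) (h2 : MemLp f 2) :
    (𝓕 (h2.toLp f) : Lp (α := V) ℂ 2) =ᵐ[volume] 𝓕 f := by
  refine ae_eq_fourier_of_forall_schwartz (Lp.memLp _) h1 fun φ => ?_
  have h := congrArg (fun T => T φ) (Lp.fourier_toTemperedDistribution_eq (h2.toLp f))
  simp only [TemperedDistribution.fourier_apply, Lp.toTemperedDistribution_apply] at h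
  rw [← h, ← SchwartzMap.fourier_coe]
  refine integral_congr_ae ?_
  filter_upwards [h2.coeFn_toLp] with x hx
  rw [hx]

lemma fourierInv_toLp_ae_eq {f : V → ℂ} (h1 : Integrable f) (h2 : MemLp f 2) :
    (𝓕⁻ (h2.toLp f) : Lp (α := V) ℂ 2) =ᵐ[volume] 𝓕⁻ f := by
  rw [Real.fourierInv_eq_fourier_comp_neg]
  refine ae_eq_fourier_of_forall_schwartz (Lp.memLp _) h1.comp_neg fun φ => ?_
  have h := congrArg (fun T => T φ) (Lp.fourierInv_toTemperedDistribution_eq (h2.toLp f))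
  simp only [TemperedDistribution.fourierInv_apply, Lp.toTemperedDistribution_apply] at h
  rw [← h, ← integral_neg_eq_self]
  refine integral_congr_ae ?_
  filter_upwards [(Measure.measurePreserving_neg (volume : Measure V)).quasiMeasurePreserving.ae
    h2.coeFn_toLp] with x hx
  rw [hx, SchwartzMap.fourierInv_coe, Real.fourierInv_eq_fourier_neg, neg_neg]

lemma memLp_fourier {f : V → ℂ} (h1 : Integrable f) (h2 : MemLp f 2) : MemLp (𝓕 f) 2 :=
  (memLp_congr_ae (fourier_toLp_ae_eq h1 h2)).1 (Lp.memLp _)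

lemma integral_mul_conj_eq_integral_fourier {f g : V → ℂ} (hf1 : Integrable f) (hf2 : MemLp f 2)
    (hg1 : Integrable g) (hg2 : MemLp g 2) :
    ∫ x, f x * (starRingEnd ℂ) (g x) = ∫ ξ, 𝓕 f ξ * (starRingEnd ℂ) (𝓕 g ξ) := by
  have h := Lp.inner_fourier_eq (hg2.toLp g) (hf2.toLp f)
  rw [L2.inner_def, L2.inner_def] at h
  refine Eq.trans ?_ (h.symm.trans ?_)
  · refine integral_congr_ae ?_
    filter_upwards [hf2.coeFn_toLp, hg2.coeFn_toLp] with x hfx hgx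
    rw [hfx, hgx, RCLike.inner_apply]
  · refine integral_congr_ae ?_
    filter_upwards [fourier_toLp_ae_eq hf1 hf2, fourier_toLp_ae_eq hg1 hg2] with x hfx hgx
    rw [hfx, hgx, RCLike.inner_apply]

lemma ae_eq_zero_of_fourier_ae_eq_zero {f : V → ℂ} (h1 : Integrable f) (h2 : MemLp f 2)
    (h : 𝓕 f =ᵐ[volume] 0) : f =ᵐ[volume] 0 := by
  have hF : (𝓕 (h2.toLp f) : Lp ℂ 2 (volume : Measure V)) = 0 :=
    Lp.eq_zero_iff_ae_eq_zero.2 ((fourier_toLp_ae_eq h1 h2).trans h)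
  have hf : h2.toLp f = 0 := by rw [← norm_eq_zero, ← Lp.norm_fourier_eq, hF, norm_zero]
  exact h2.coeFn_toLp.symm.trans (Lp.eq_zero_iff_ae_eq_zero.1 hf)

lemma fourier_comp_sub_right (f : V → ℂ) (y ξ : V) :
    𝓕 (fun x => f (x - y)) ξ = 𝐞 (-inner ℝ y ξ) * 𝓕 f ξ := by
  have h := congrFun (VectorFourier.fourierIntegral_comp_add_right 𝐞 volume (innerₗ V) f (-y)) ξ
  rw [map_neg, LinearMap.neg_apply, innerₗ_apply_apply, Circle.smul_def, smul_eq_mul] at h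
  simpa only [sub_eq_add_neg] using! h

/-- The cosine transform `ξ ↦ ∫ h(x) cos (2π⟨x, ξ⟩) dx` of a real function: for even functions it
is the Fourier transform. -/
noncomputable def cosTransform (h : V → ℝ) (ξ : V) : ℝ :=
  ∫ x, h x * Real.cos (2 * Real.pi * inner ℝ x ξ)

variable {g h : V → ℝ}

lemma integrable_mul_cos (hh : Integrable h) (ξ : V) :
    Integrable fun x => h x * Real.cos (2 * Real.pi * inner ℝ x ξ) :=
  hh.mul_bdd (c := 1) (by fun_prop) (Eventually.of_forall fun x => Real.abs_cos_le_one _)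

lemma continuous_cosTransform (hh : Integrable h) : Continuous (cosTransform h) :=
  continuous_of_dominated (fun ξ => (integrable_mul_cos hh ξ).aestronglyMeasurable)
    (fun ξ => Eventually.of_forall fun x => by
      rw [norm_mul]
      exact mul_le_of_le_one_right (norm_nonneg _) (Real.abs_cos_le_one _)) hh.norm
    (Eventually.of_forall fun x => by fun_prop)

lemma even_cosTransform (h : V → ℝ) : (cosTransform h).Even := fun ξ => by simp [cosTransform]

lemma cosTransform_const_mul (c : ℝ) (h : V → ℝ) (ξ : V) :
    cosTransform (fun x => c * h x) ξ = c * cosTransform h ξ := by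
  simp only [cosTransform, mul_assoc, integral_const_mul]

lemma fourier_re_eq_cosTransform (hh : Integrable h) (ξ : V) :
    (𝓕 (fun x => (h x : ℂ)) ξ).re = cosTransform h ξ := by
  have hint : Integrable fun x => 𝐞 (-inner ℝ x ξ) • (h x : ℂ) :=
    (Real.fourierIntegral_convergent_iff ξ).2 hh.ofReal
  rw [Real.fourier_eq, cosTransform]
  refine (integral_re hint).symm.trans (integral_congr_ae (Eventually.of_forall fun x => ?_))
  simp [Circle.smul_def, Real.fourierChar_apply, Complex.exp_re, mul_comm]

lemma fourier_ofReal_eq_cosTransform (hh : Integrable h) (heven : h.Even) (ξ : V) :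
    𝓕 (fun x => (h x : ℂ)) ξ = cosTransform h ξ := by
  have hconj : (starRingEnd ℂ) (𝓕 (fun x => (h x : ℂ)) ξ) = 𝓕 (fun x => (h x : ℂ)) ξ := by
    rw [Real.fourier_eq, ← integral_conj, ← integral_neg_eq_self]
    refine integral_congr_ae (Eventually.of_forall fun x => ?_)
    simp [heven x, Circle.smul_def, ← Circle.coe_inv_eq_conj, ← AddChar.map_neg_eq_inv]
  rw [← fourier_re_eq_cosTransform hh, Complex.conj_eq_iff_re.1 hconj]

lemma fourier_ofReal_comp_sub_right (hh : Integrable h) (heven : h.Even) (y ξ : V) :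
    𝓕 (fun x => (h (x - y) : ℂ)) ξ = 𝐞 (-inner ℝ y ξ) * cosTransform h ξ := by
  rw [fourier_comp_sub_right fun x => (h x : ℂ), fourier_ofReal_eq_cosTransform hh heven]

lemma fourierInv_ofReal_eq_cosTransform (hh : Integrable h) (heven : h.Even) (ξ : V) :
    𝓕⁻ (fun x => (h x : ℂ)) ξ = cosTransform h ξ := by
  rw [Real.fourierInv_eq_fourier_neg, fourier_ofReal_eq_cosTransform hh heven, even_cosTransform]

lemma tendsto_cosTransform_cocompact (hh : Integrable h) :
    Tendsto (cosTransform h) (cocompact V) (𝓝 0) := by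
  have hlim := (Complex.continuous_re.tendsto 0).comp
    (tendsto_integral_exp_inner_smul_cocompact fun x => (h x : ℂ))
  exact hlim.congr fun ξ => fourier_re_eq_cosTransform hh ξ

lemma memLp_cosTransform (hh1 : Integrable h) (hh2 : MemLp h 2) : MemLp (cosTransform h) 2 :=
  (memLp_congr_ae (Eventually.of_forall (fourier_re_eq_cosTransform hh1))).1
    (memLp_fourier hh1.ofReal (hh2.ofReal (K := ℂ))).re

/-- By Plancherel, translation becoming multiplication by a character. -/
lemma integral_comp_sub_mul_comp_sub (hg1 : Integrable g) (hg2 : MemLp g 2) (hge : g.Even)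
    (hh1 : Integrable h) (hh2 : MemLp h 2) (hhe : h.Even) (y z : V) :
    ∫ x, g (x - y) * h (x - z) =
      cosTransform (fun ξ => cosTransform g ξ * cosTransform h ξ) (z - y) := by
  have hm : Integrable fun ξ => cosTransform g ξ * cosTransform h ξ :=
    (memLp_cosTransform hg1 hg2).integrable_mul (memLp_cosTransform hh1 hh2)
  have hme : (fun ξ => cosTransform g ξ * cosTransform h ξ).Even :=
    (even_cosTransform g).mul_even (even_cosTransform h)
  have hplancherel : ∫ x, (g (x - y) : ℂ) * (starRingEnd ℂ) (h (x - z) : ℂ) =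
      ∫ ξ, 𝓕 (fun x => (g (x - y) : ℂ)) ξ * (starRingEnd ℂ) (𝓕 (fun x => (h (x - z) : ℂ)) ξ) :=
    integral_mul_conj_eq_integral_fourier (hg1.comp_sub_right y).ofReal
      ((hg2.comp_measurePreserving (measurePreserving_sub_right volume y)).ofReal (K := ℂ))
      (hh1.comp_sub_right z).ofReal
      ((hh2.comp_measurePreserving (measurePreserving_sub_right volume z)).ofReal (K := ℂ))
  rw [← Complex.ofReal_inj, ← fourierInv_ofReal_eq_cosTransform hm hme, Real.fourierInv_eq,
    ← integral_complex_ofReal]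
  refine Eq.trans ?_ (hplancherel.trans ?_)
  · simp
  · refine integral_congr_ae (Eventually.of_forall fun ξ => ?_)
    have hchar : (𝐞 (inner ℝ ξ (z - y)) : ℂ) = 𝐞 (-inner ℝ y ξ) * 𝐞 (inner ℝ z ξ) := by
      rw [← Circle.coe_mul, ← AddChar.map_add_eq_mul, inner_sub_right, real_inner_comm y,
        real_inner_comm z, sub_eq_neg_add]
    beta_reduce
    rw [fourier_ofReal_comp_sub_right hg1 hge, fourier_ofReal_comp_sub_right hh1 hhe, map_mul,
      Complex.conj_ofReal, ← Circle.coe_inv_eq_conj, ← AddChar.map_neg_eq_inv, neg_neg,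
      Circle.smul_def, smul_eq_mul, hchar]
    push_cast
    ring

lemma convolution_eq_cosTransform_mul (hg1 : Integrable g) (hg2 : MemLp g 2) (hge : g.Even)
    (hh1 : Integrable h) (hh2 : MemLp h 2) (hhe : h.Even) :
    convolution g h (ContinuousLinearMap.mul ℝ ℝ) volume =
      cosTransform (fun ξ => cosTransform g ξ * cosTransform h ξ) := by
  ext w
  have hcorr := integral_comp_sub_mul_comp_sub hg1 hg2 hge hh1 hh2 hhe 0 w
  simp only [sub_zero] at hcorr
  rw [← hcorr, convolution_def]
  refine integral_congr_ae (Eventually.of_forall fun x => ?_)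
  simp [← hhe (x - w)]

lemma integrable_cosTransform_mul (hg1 : Integrable g) (hg2 : MemLp g 2) (hge : g.Even)
    (hh1 : Integrable h) (hh2 : MemLp h 2) (hhe : h.Even) :
    Integrable (cosTransform fun ξ => cosTransform g ξ * cosTransform h ξ) :=
  convolution_eq_cosTransform_mul hg1 hg2 hge hh1 hh2 hhe ▸ hg1.integrable_convolution _ hh1

lemma cosTransform_cosTransform (hcont : Continuous h) (heven : h.Even) (hh : Integrable h)
    (hcos : Integrable (cosTransform h)) : cosTransform (cosTransform h) = h := by
  have hF : 𝓕 (fun x => (h x : ℂ)) = fun ξ => (cosTransform h ξ : ℂ) :=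
    funext (fourier_ofReal_eq_cosTransform hh heven)
  have hinv := Continuous.fourierInv_fourier_eq (f := fun x => (h x : ℂ)) (by fun_prop) hh.ofReal
    (hF ▸ hcos.ofReal)
  ext x
  have hx := congrFun hinv x
  rw [hF, fourierInv_ofReal_eq_cosTransform hcos (even_cosTransform h)] at hx
  exact_mod_cast hx

end Fourier

section PositiveDefinite

/-- A map `v` into an inner product space whose Gram matrix is the translation invariant kernel
`(y, z) ↦ K (z - y)`: the existence of such a map says that `K` is positive definite. -/
def IsFeatureMap {V H : Type*} [AddGroup V] [NormedAddCommGroup H] [InnerProductSpace ℝ H]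
    (v : V → H) (K : V → ℝ) : Prop :=
  ∀ y z, inner ℝ (v y) (v z) = K (z - y)

namespace IsFeatureMap

section AddGroup

variable {V H : Type*} [AddGroup V] [NormedAddCommGroup H] [InnerProductSpace ℝ H]
  {v : V → H} {K : V → ℝ}

lemma norm_sq (hv : IsFeatureMap v K) (y : V) : ‖v y‖ ^ 2 = K 0 := by
  rw [← real_inner_self_eq_norm_sq, hv, sub_self]

lemma abs_le (hv : IsFeatureMap v K) (w : V) : |K w| ≤ K 0 := by
  have hw : K w = inner ℝ (v 0) (v w) := by rw [hv, sub_zero]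
  have hcs : |K w| ≤ ‖v 0‖ * ‖v w‖ := hw ▸ abs_real_inner_le_norm _ _
  have hamgm := two_mul_le_add_sq ‖v 0‖ ‖v w‖
  rw [hv.norm_sq, hv.norm_sq] at hamgm
  linarith

lemma norm_sub_sq (hv : IsFeatureMap v K) (y z : V) :
    ‖v z - v y‖ ^ 2 = 2 * K 0 - 2 * K (z - y) := by
  rw [norm_sub_sq_real, hv.norm_sq, hv.norm_sq, real_inner_comm, hv]
  ring

lemma continuous [TopologicalSpace V] [ContinuousSub V] (hv : IsFeatureMap v K)
    (hK : Continuous K) : Continuous v := by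
  refine continuous_iff_continuousAt.2 fun y => tendsto_iff_norm_sub_tendsto_zero.2 ?_
  have hcont : Continuous fun z => √(2 * K 0 - 2 * K (z - y)) := by fun_prop
  have hlim : Tendsto (fun z => √(2 * K 0 - 2 * K (z - y))) (𝓝 y) (𝓝 0) := by
    simpa using hcont.tendsto y
  exact hlim.congr fun z => by rw [← hv.norm_sub_sq, Real.sqrt_sq (norm_nonneg _)]

end AddGroup

/-- The factor `cos (2π⟨z - y, ξ⟩)` is the Gram matrix of the points
`(cos (2π⟨y, ξ⟩), sin (2π⟨y, ξ⟩))` of the unit circle. -/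
lemma mul_cos {V H : Type*} [NormedAddCommGroup V] [InnerProductSpace ℝ V] [NormedAddCommGroup H]
    [InnerProductSpace ℝ H] {v : V → H} {K : V → ℝ} (hv : IsFeatureMap v K) (ξ : V) :
    IsFeatureMap (fun y => WithLp.toLp 2 (Real.cos (2 * Real.pi * inner ℝ y ξ) • v y,
      Real.sin (2 * Real.pi * inner ℝ y ξ) • v y))
      fun w => K w * Real.cos (2 * Real.pi * inner ℝ w ξ) := by
  intro y z
  simp only [WithLp.prod_inner_apply, real_inner_smul_left, real_inner_smul_right, hv y z,
    inner_sub_left, mul_sub, Real.cos_sub]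
  ring

lemma integral_integral_nonneg {V H : Type*} [NormedAddCommGroup V] [SecondCountableTopology V]
    [MeasurableSpace V] [OpensMeasurableSpace V] [NormedAddCommGroup H] [InnerProductSpace ℝ H]
    [CompleteSpace H] {v : V → H} {K : V → ℝ} (hv : IsFeatureMap v K) (hK : Continuous K)
    {μ : Measure V} {f : V → ℝ} (hf : Integrable f μ) :
    0 ≤ ∫ y, ∫ z, f y * f z * K (z - y) ∂μ ∂μ := by
  have hbound : ∀ y, ‖v y‖ ≤ √(K 0) := fun y => Real.le_sqrt_of_sq_le (hv.norm_sq y).le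
  have hint : Integrable (fun y => f y • v y) μ :=
    hf.smul_bdd _ (hv.continuous hK).aestronglyMeasurable (Eventually.of_forall hbound)
  have hnonneg : 0 ≤ inner ℝ (∫ y, f y • v y ∂μ) (∫ y, f y • v y ∂μ) := real_inner_self_nonneg
  rw [← integral_inner hint] at hnonneg
  refine hnonneg.trans_eq (integral_congr_ae (Eventually.of_forall fun y => ?_))
  beta_reduce
  rw [real_inner_comm, ← integral_inner hint]
  refine integral_congr_ae (Eventually.of_forall fun z => ?_)
  beta_reduce
  rw [real_inner_smul_left, real_inner_smul_right, hv]
  ring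

end IsFeatureMap

lemma integral_integral_mul_comp_sub {G : Type*} [AddGroup G] [MeasurableSpace G]
    [MeasurableAdd₂ G] {μ : Measure G} [SFinite μ] [μ.IsAddRightInvariant] {f K : G → ℝ} {C : ℝ}
    (hf : Integrable f μ) (hK : AEStronglyMeasurable K μ) (hC : ∀ w, |K w| ≤ C) :
    ∫ y, ∫ z, f y * f z * K (z - y) ∂μ ∂μ = ∫ w, (∫ y, f y * f (w + y) ∂μ) * K w ∂μ := by
  have hint : Integrable (fun p : G × G => f p.1 * f (p.2 + p.1) * K p.2) (μ.prod μ) :=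
    ((measurePreserving_prod_add_right μ μ).integrable_comp_of_integrable
      (hf.mul_prod hf)).mul_bdd hK.comp_snd (Eventually.of_forall fun p => hC p.2)
  calc ∫ y, ∫ z, f y * f z * K (z - y) ∂μ ∂μ
      = ∫ y, ∫ w, f y * f (w + y) * K w ∂μ ∂μ := by
        refine integral_congr_ae (Eventually.of_forall fun y => ?_)
        beta_reduce
        rw [← integral_add_right_eq_self _ y]
        simp only [add_sub_cancel_right]
    _ = ∫ w, ∫ y, f y * f (w + y) * K w ∂μ ∂μ := integral_integral_swap hint
    _ = ∫ w, (∫ y, f y * f (w + y) ∂μ) * K w ∂μ := by simp only [integral_mul_const]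

variable {V : Type*} [NormedAddCommGroup V] [InnerProductSpace ℝ V] [FiniteDimensional ℝ V]
  [MeasurableSpace V] [BorelSpace V]

lemma integrable_exp_neg_mul_sq_norm {b : ℝ} (hb : 0 < b) :
    Integrable fun y : V => Real.exp (-b * ‖y‖ ^ 2) := by
  refine not_imp_comm.1 integral_undef ?_
  rw [GaussianFourier.integral_rexp_neg_mul_sq_norm hb]
  positivity

lemma integral_exp_mul_exp_add_right (b : ℝ) (w : V) :
    ∫ y, Real.exp (-(2 * b) * ‖y‖ ^ 2) * Real.exp (-(2 * b) * ‖w + y‖ ^ 2) =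
      (∫ u : V, Real.exp (-(4 * b) * ‖u‖ ^ 2)) * Real.exp (-b * ‖w‖ ^ 2) := by
  rw [← integral_sub_right_eq_self _ ((1 / 2 : ℝ) • w), ← integral_mul_const]
  refine integral_congr_ae (Eventually.of_forall fun u => ?_)
  have hparallelogram := parallelogram_law_with_norm ℝ u ((1 / 2 : ℝ) • w)
  have hhalf : ‖(1 / 2 : ℝ) • w‖ = ‖w‖ / 2 := by
    rw [norm_smul, Real.norm_of_nonneg one_half_pos.le, one_div_mul_eq_div]
  have hsum : w + (u - (1 / 2 : ℝ) • w) = u + (1 / 2 : ℝ) • w := by module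
  beta_reduce
  rw [← Real.exp_add, ← Real.exp_add, hsum]
  rw [hhalf] at hparallelogram
  congr 1
  linear_combination (-2 * b) * hparallelogram

namespace IsFeatureMap

variable {H : Type*} [NormedAddCommGroup H] [InnerProductSpace ℝ H] [CompleteSpace H]
  {v : V → H} {K : V → ℝ}

lemma integral_exp_mul_nonneg (hv : IsFeatureMap v K) (hK : Continuous K) {b : ℝ} (hb : 0 < b) :
    0 ≤ ∫ w, Real.exp (-b * ‖w‖ ^ 2) * K w := by
  have hgauss : Integrable fun y : V => Real.exp (-(2 * b) * ‖y‖ ^ 2) :=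
    integrable_exp_neg_mul_sq_norm (by positivity)
  have hnonneg := hv.integral_integral_nonneg hK hgauss
  rw [integral_integral_mul_comp_sub hgauss hK.aestronglyMeasurable hv.abs_le] at hnonneg
  simp only [integral_exp_mul_exp_add_right, mul_assoc, integral_const_mul] at hnonneg
  refine nonneg_of_mul_nonneg_right hnonneg (integral_exp_pos ?_)
  exact integrable_exp_neg_mul_sq_norm (b := 4 * b) (by positivity)

lemma integral_nonneg (hv : IsFeatureMap v K) (hK : Continuous K) (hint : Integrable K) :
    0 ≤ ∫ w, K w := by
  have hint' : Integrable fun w => (K w : ℂ) := hint.ofReal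
  have hlim := (Complex.continuous_re.tendsto _).comp (Real.tendsto_integral_cexp_sq_smul hint')
  rw [integral_complex_ofReal, Complex.ofReal_re] at hlim
  refine ge_of_tendsto hlim ((eventually_gt_atTop 0).mono fun c hc => ?_)
  refine (hv.integral_exp_mul_nonneg hK (inv_pos.2 hc)).trans_eq ?_
  rw [Function.comp_apply, ← Complex.ofReal_re (∫ w, _), ← integral_complex_ofReal]
  congr 2 with w
  push_cast
  rw [smul_eq_mul]

lemma cosTransform_nonneg (hv : IsFeatureMap v K) (hK : Continuous K) (hint : Integrable K)
    (ξ : V) : 0 ≤ cosTransform K ξ :=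
  (hv.mul_cos ξ).integral_nonneg (by fun_prop) (integrable_mul_cos hint ξ)

end IsFeatureMap

end PositiveDefinite

section SpanOfFeatures

variable {E T L : Type} [MeasureSpace E] [NormedAddCommGroup L] [InnerProductSpace ℝ L]

lemma dense_submoduleOf_topologicalClosure (W : Submodule ℝ L) :
    Dense (W.submoduleOf W.topologicalClosure : Set W.topologicalClosure) := by
  intro x
  rw [closure_subtype]
  refine closure_mono (fun y hy => ?_) x.2
  exact ⟨⟨y, W.le_topologicalClosure hy⟩, hy, rfl⟩

/-- The Hilbert space of functions carried by the closure of the domain of an injective linear map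
`t`, the vector `f` of the domain being identified with the function `t f`. -/
noncomputable def FunctionHilbertSpace.ofLinearPMap [CompleteSpace L]
    (t : L →ₗ.[ℝ] (E →ₘ[volume] ℝ)) (ht : Function.Injective t.toFun) : FunctionHilbertSpace E where
  H := t.domain.topologicalClosure
  complete := t.domain.isClosed_topologicalClosure.completeSpace_coe
  core := t.domain.submoduleOf t.domain.topologicalClosure
  dense_core := dense_submoduleOf_topologicalClosure t.domain
  toFun := t.toFun ∘ₗ (Submodule.submoduleOfEquivOfLe t.domain.le_topologicalClosure).toLinearMap
  toFun_injective := ht.comp (LinearEquiv.injective _)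

lemma FunctionHilbertSpace.hasAveragingKernel_ofLinearPMap [CompleteSpace L]
    {t : L →ₗ.[ℝ] (E →ₘ[volume] ℝ)} (ht : Function.Injective t.toFun) {ω : T → Set E}
    {A : E → T → ℝ} (v : T → t.domain) (hA : ∀ τ, t (v τ) =ᵐ[volume] fun x => A x τ)
    (hint : ∀ f τ, IntegrableOn (t f) (ω τ))
    (havg : ∀ (f : t.domain) τ, ⨍ x in ω τ, t f x = inner ℝ (f : L) (v τ)) :
    (FunctionHilbertSpace.ofLinearPMap t ht).HasAveragingKernel ω A := by
  let e := Submodule.submoduleOfEquivOfLe t.domain.le_topologicalClosure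
  refine ⟨fun f τ => hint (e f) τ, fun τ => innerSL ℝ (e.symm (v τ)).1, fun τ f => ?_,
    fun τ => ⟨e.symm (v τ), ?_, fun f => real_inner_comm _ _⟩⟩
  · exact (real_inner_comm _ _).trans (havg (e f) τ).symm
  · exact hA τ

lemma integrableOn_and_setAverage_eq_of_mem_span {h : T → (E →ₘ[volume] ℝ)} {v : T → L} {s : Set E}
    {w : L} (hint : ∀ τ, IntegrableOn (h τ) s) (havg : ∀ τ, ⨍ x in s, h τ x = inner ℝ (v τ) w)
    {p : L × (E →ₘ[volume] ℝ)} (hp : p ∈ Submodule.span ℝ (range fun τ => (v τ, h τ))) :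
    IntegrableOn p.2 s ∧ ⨍ x in s, p.2 x = inner ℝ p.1 w := by
  induction hp using Submodule.span_induction with
  | mem p hp =>
    obtain ⟨τ, rfl⟩ := hp
    exact ⟨hint τ, havg τ⟩
  | zero =>
    have hzero : ((0 : E →ₘ[volume] ℝ) : E → ℝ) =ᵐ[volume.restrict s] 0 :=
      ae_restrict_of_ae AEEqFun.coeFn_zero
    refine ⟨(integrable_zero _ _ _).congr hzero.symm, ?_⟩
    rw [Prod.fst_zero, inner_zero_left, Prod.snd_zero, average_congr hzero]
    simp only [Pi.zero_apply, average_zero]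
  | add p q _ _ hp hq =>
    have hadd : (p.2 + q.2 : E →ₘ[volume] ℝ) =ᵐ[volume.restrict s] (p.2 + q.2 : E → ℝ) :=
      ae_restrict_of_ae (AEEqFun.coeFn_add _ _)
    refine ⟨(hp.1.add hq.1).congr hadd.symm, ?_⟩
    rw [Prod.fst_add, inner_add_left, ← hp.2, ← hq.2, Prod.snd_add, average_congr hadd]
    exact integral_add hp.1.to_average hq.1.to_average
  | smul r p _ hp =>
    have hsmul : (r • p.2 : E →ₘ[volume] ℝ) =ᵐ[volume.restrict s] (r • p.2 : E → ℝ) :=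
      ae_restrict_of_ae (AEEqFun.coeFn_smul _ _)
    refine ⟨(hp.1.smul r).congr hsmul.symm, ?_⟩
    rw [Prod.smul_fst, real_inner_smul_left, ← hp.2, Prod.smul_snd, average_congr hsmul]
    exact integral_smul r _

/-- The Hilbert space is the closed span of the vectors `v τ`, and the relation hypothesis says that
`v τ ↦ h τ` extends to an injective linear map on the span. -/
lemma isAveragingKernel_of_inner_eq_setAverage [CompleteSpace L] {ω : T → Set E} {A : E → T → ℝ}
    (v : T → L) (h : T → (E →ₘ[volume] ℝ)) (hA : ∀ τ, h τ =ᵐ[volume] fun x => A x τ)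
    (hker : ∀ p ∈ Submodule.span ℝ (range fun τ => (v τ, h τ)), p.1 = 0 ↔ p.2 = 0)
    (hint : ∀ σ τ, IntegrableOn (h σ) (ω τ))
    (havg : ∀ σ τ, ⨍ x in ω τ, h σ x = inner ℝ (v σ) (v τ)) : IsAveragingKernel ω A := by
  let G := Submodule.span ℝ (range fun τ => (v τ, h τ))
  let t := G.toLinearPMap
  have hgraph : t.graph = G := G.toLinearPMap_graph_eq fun p hp => (hker p hp).1
  have hmem : ∀ f : t.domain, ((f : L), t f) ∈ G := fun f => hgraph ▸ t.mem_graph f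
  have hv : ∀ τ, ∃ f : t.domain, (f : L) = v τ ∧ t f = h τ := fun τ => by
    rw [← t.mem_graph_iff (x := (v τ, h τ)), hgraph]
    exact Submodule.subset_span (mem_range_self τ)
  choose u hu htu using hv
  have ht : Function.Injective t.toFun := (injective_iff_map_eq_zero _).2 fun f hf =>
    Subtype.ext ((hker _ (hmem f)).2 hf)
  refine ⟨_, FunctionHilbertSpace.hasAveragingKernel_ofLinearPMap ht u (fun τ => ?_)
    (fun f τ => ?_) fun f τ => ?_⟩
  · rw [htu]
    exact hA τ
  · exact (integrableOn_and_setAverage_eq_of_mem_span (hint · τ) (havg · τ) (hmem f)).1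
  · rw [hu]
    exact (integrableOn_and_setAverage_eq_of_mem_span (hint · τ) (havg · τ) (hmem f)).2

end SpanOfFeatures

section Averaging

section InnerProductSpace

variable {V : Type*} [NormedAddCommGroup V] [InnerProductSpace ℝ V] [FiniteDimensional ℝ V]
  [MeasurableSpace V] [BorelSpace V]

lemma memLp_fourierChar_mul_sqrt {w : V → ℝ} (hw : Integrable w) (y : V) :
    MemLp (fun ξ => 𝐞 (-inner ℝ y ξ) * (√(w ξ) : ℂ)) 2 := by
  have hmeas : AEStronglyMeasurable (fun ξ => 𝐞 (-inner ℝ y ξ) * (√(w ξ) : ℂ)) := by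
    have hchar : Continuous fun ξ => (𝐞 (-inner ℝ y ξ) : ℂ) :=
      continuous_subtype_val.comp (Real.continuous_fourierChar.comp (by fun_prop))
    exact hchar.aestronglyMeasurable.mul (Complex.continuous_ofReal.comp_aestronglyMeasurable
      (Real.continuous_sqrt.comp_aestronglyMeasurable hw.aestronglyMeasurable))
  rw [memLp_two_iff_integrable_sq_norm hmeas]
  refine hw.pos_part.congr (Eventually.of_forall fun ξ => ?_)
  beta_reduce
  rw [norm_mul, Circle.norm_coe, one_mul, Complex.norm_real, Real.norm_eq_abs, sq_abs,
    Real.sq_sqrt']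

/-- The easy direction of Bochner's theorem. -/
lemma exists_isFeatureMap_cosTransform {w : V → ℝ} (hw : Integrable w) (hpos : ∀ ξ, 0 ≤ w ξ) :
    ∃ v : V → Lp ℂ 2 (volume : Measure V), IsFeatureMap v (cosTransform w) ∧
      ∀ y, v y =ᵐ[volume] fun ξ => 𝐞 (-inner ℝ y ξ) * (√(w ξ) : ℂ) := by
  refine ⟨fun y => (memLp_fourierChar_mul_sqrt hw y).toLp, fun y z => ?_,
    fun y => (memLp_fourierChar_mul_sqrt hw y).coeFn_toLp⟩
  rw [L2.inner_def, cosTransform]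
  refine integral_congr_ae ?_
  filter_upwards [(memLp_fourierChar_mul_sqrt hw y).coeFn_toLp,
    (memLp_fourierChar_mul_sqrt hw z).coeFn_toLp] with ξ hy hz
  have hchar : 𝐞 (-inner ℝ z ξ) * (starRingEnd ℂ) (𝐞 (-inner ℝ y ξ)) =
      (𝐞 (-inner ℝ (z - y) ξ) : ℂ) := by
    rw [← Circle.coe_inv_eq_conj, ← AddChar.map_neg_eq_inv, ← Circle.coe_mul,
      ← AddChar.map_add_eq_mul, inner_sub_left, neg_sub, neg_neg,
      neg_add_eq_sub]
  have hre : (𝐞 (-inner ℝ (z - y) ξ) : ℂ).re = Real.cos (2 * Real.pi * inner ℝ ξ (z - y)) := by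
    rw [Real.fourierChar_apply, Complex.exp_ofReal_mul_I_re, mul_neg, Real.cos_neg,
      real_inner_comm]
  have hsq : (√(w ξ) : ℂ) * √(w ξ) = w ξ := by
    rw [← Complex.ofReal_mul, Real.mul_self_sqrt (hpos ξ)]
  rw [hy, hz, Complex.inner, map_mul, Complex.conj_ofReal, mul_mul_mul_comm, hchar, hsq,
    Complex.re_mul_ofReal, hre, mul_comm]

section Span

variable {ι : Type*} {v : ι → Lp ℂ 2 (volume : Measure V)} {h : ι → (V →ₘ[volume] ℝ)}
  {e : ι → V → ℂ} {s G : V → ℂ} {p : Lp ℂ 2 (volume : Measure V) × (V →ₘ[volume] ℝ)}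

lemma exists_fourier_eq_mul_of_mem_span (hv : ∀ i, v i =ᵐ[volume] e i * s)
    (h1 : ∀ i, Integrable (h i)) (h2 : ∀ i, MemLp (h i) 2)
    (hF : ∀ i, 𝓕 (fun x => (h i x : ℂ)) = e i * G)
    (hp : p ∈ Submodule.span ℝ (range fun i => (v i, h i))) :
    Integrable p.2 ∧ MemLp p.2 2 ∧
      ∃ q : V → ℂ, p.1 =ᵐ[volume] q * s ∧ 𝓕 (fun x => (p.2 x : ℂ)) = q * G := by
  induction hp using Submodule.span_induction with
  | mem p hp =>
    obtain ⟨i, rfl⟩ := hp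
    exact ⟨h1 i, h2 i, e i, hv i, hF i⟩
  | zero =>
    have hzero : ((0 : V →ₘ[volume] ℝ) : V → ℝ) =ᵐ[volume] 0 := AEEqFun.coeFn_zero
    refine ⟨(integrable_zero _ _ _).congr hzero.symm, MemLp.zero.ae_eq hzero.symm, 0, ?_, ?_⟩
    · rw [zero_mul]
      exact Lp.coeFn_zero ℂ 2 _
    · rw [zero_mul, ← fourier_zero_fun]
      exact fourier_congr (hzero.mono fun x hx => by simp [hx])
  | add p q _ _ hp hq =>
    obtain ⟨hp1, hp2, a, hpa, hpF⟩ := hp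
    obtain ⟨hq1, hq2, b, hqb, hqF⟩ := hq
    have hadd : (p.2 + q.2 : V →ₘ[volume] ℝ) =ᵐ[volume] (p.2 + q.2 : V → ℝ) :=
      AEEqFun.coeFn_add _ _
    refine ⟨(hp1.add hq1).congr hadd.symm, (hp2.add hq2).ae_eq hadd.symm, a + b, ?_, ?_⟩
    · rw [add_mul]
      exact (Lp.coeFn_add p.1 q.1).trans (hpa.add hqb)
    · have hsum := fourier_add_fun (V := V) (hp1.ofReal (𝕜 := ℂ)) (hq1.ofReal (𝕜 := ℂ))
      rw [add_mul, ← hpF, ← hqF]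
      refine Eq.trans ?_ hsum
      exact fourier_congr (hadd.mono fun x hx => by simp [hx])
  | smul r p _ hp =>
    obtain ⟨hp1, hp2, a, hpa, hpF⟩ := hp
    have hsmul : (r • p.2 : V →ₘ[volume] ℝ) =ᵐ[volume] (r • p.2 : V → ℝ) :=
      AEEqFun.coeFn_smul _ _
    refine ⟨(hp1.smul r).congr hsmul.symm, (hp2.const_smul r).ae_eq hsmul.symm, (r : ℂ) • a, ?_, ?_⟩
    · rw [smul_mul_assoc]
      exact (Lp.coeFn_smul r p.1).trans (hpa.const_smul r)
    · rw [smul_mul_assoc, ← hpF, ← fourier_const_smul_fun]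
      exact fourier_congr (hsmul.mono fun x hx => by simp [hx])

lemma fst_eq_zero_iff_of_mem_span (hv : ∀ i, v i =ᵐ[volume] e i * s)
    (h1 : ∀ i, Integrable (h i)) (h2 : ∀ i, MemLp (h i) 2)
    (hF : ∀ i, 𝓕 (fun x => (h i x : ℂ)) = e i * G) (hsG : ∀ᵐ ξ, s ξ = 0 ↔ G ξ = 0)
    (hp : p ∈ Submodule.span ℝ (range fun i => (v i, h i))) : p.1 = 0 ↔ p.2 = 0 := by
  obtain ⟨hp1, hp2, q, hq, hqF⟩ := exists_fourier_eq_mul_of_mem_span hv h1 h2 hF hp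
  have hfst : p.1 = 0 ↔ q * s =ᵐ[volume] 0 := by
    rw [Lp.eq_zero_iff_ae_eq_zero]
    exact ⟨hq.symm.trans, hq.trans⟩
  have hsnd : p.2 = 0 ↔ (fun x => (p.2 x : ℂ)) =ᵐ[volume] 0 := by
    rw [AEEqFun.ext_iff, AEEqFun.coeFn_zero.congr_right]
    exact eventually_congr (Eventually.of_forall fun x => Complex.ofReal_eq_zero.symm)
  have hmid : q * s =ᵐ[volume] 0 ↔ q * G =ᵐ[volume] 0 := by
    refine eventually_congr (hsG.mono fun ξ hξ => ?_)
    simp only [Pi.mul_apply, Pi.zero_apply, mul_eq_zero, hξ]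
  rw [hfst, hsnd, hmid, ← hqF]
  refine ⟨ae_eq_zero_of_fourier_ae_eq_zero hp1.ofReal (hp2.ofReal (K := ℂ)), fun hzero => ?_⟩
  rw [fourier_congr hzero, fourier_zero_fun]

end Span

section Translates

variable {ω : Set V}

lemma even_indicator_one {G : Type*} [InvolutiveNeg G] {ω : Set G} (hsymm : ∀ x ∈ ω, -x ∈ ω) :
    (ω.indicator (1 : G → ℝ)).Even := by
  intro x
  have hx : -x ∈ ω ↔ x ∈ ω := ⟨fun h => neg_neg x ▸ hsymm _ h, hsymm x⟩
  by_cases h : x ∈ ω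
  · rw [indicator_of_mem (hx.2 h), indicator_of_mem h, Pi.one_apply, Pi.one_apply]
  · rw [indicator_of_notMem (mt hx.1 h), indicator_of_notMem h]

lemma integrable_indicator_one (hω : MeasurableSet ω) (hfin : volume ω ≠ ⊤) :
    Integrable (ω.indicator (1 : V → ℝ)) :=
  (integrable_indicator_iff hω).2 (integrableOn_const hfin)

lemma memLp_indicator_one (hω : MeasurableSet ω) (hfin : volume ω ≠ ⊤) :
    MemLp (ω.indicator (1 : V → ℝ)) 2 :=
  memLp_indicator_const 2 hω 1 (Or.inr hfin)

lemma setAverage_image_add_left (hω : MeasurableSet ω) (f : V → ℝ) (y : V) :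
    ⨍ x in (fun x => y + x) '' ω, f x =
      (volume.real ω)⁻¹ * ∫ x, f x * ω.indicator 1 (x - y) := by
  have hmem : ∀ x, x ∈ (fun x => -y + x) ⁻¹' ω ↔ x - y ∈ ω := fun x => by
    rw [mem_preimage, neg_add_eq_sub]
  rw [image_add_left, setAverage_eq, measureReal_def, measure_preimage_add, ← measureReal_def,
    smul_eq_mul, ← integral_indicator (measurable_const_add _ hω)]
  congr 2 with x
  by_cases h : x - y ∈ ω
  · rw [indicator_of_mem ((hmem x).2 h), indicator_of_mem h, Pi.one_apply, mul_one]
  · rw [indicator_of_notMem (mt (hmem x).1 h), indicator_of_notMem h, mul_zero]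

variable {g : V → ℝ}

/-- Up to normalization, the Fourier transform of the convolution of `g` with the indicator function
of `ω`: the spectral density of the Gram matrix of an averaging kernel. -/
noncomputable def averagingSymbol (ω : Set V) (g : V → ℝ) (ξ : V) : ℝ :=
  (volume.real ω)⁻¹ * (cosTransform g ξ * cosTransform (ω.indicator 1) ξ)

lemma even_averagingSymbol (ω : Set V) (g : V → ℝ) : (averagingSymbol ω g).Even := fun ξ => by
  simp only [averagingSymbol, even_cosTransform _ ξ]

lemma averagingSymbol_nonneg_iff (hfin : volume ω ≠ ⊤) (hpos : volume ω ≠ 0) (ξ : V) :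
    0 ≤ averagingSymbol ω g ξ ↔ 0 ≤ cosTransform g ξ * cosTransform (ω.indicator 1) ξ :=
  mul_nonneg_iff_of_pos_left (inv_pos.2 (ENNReal.toReal_pos hpos hfin))

lemma continuous_averagingSymbol (hω : MeasurableSet ω) (hfin : volume ω ≠ ⊤)
    (hg1 : Integrable g) : Continuous (averagingSymbol ω g) :=
  ((continuous_cosTransform hg1).mul
    (continuous_cosTransform (integrable_indicator_one hω hfin))).const_mul _

lemma integrable_averagingSymbol (hω : MeasurableSet ω) (hfin : volume ω ≠ ⊤)
    (hg1 : Integrable g) (hg2 : MemLp g 2) : Integrable (averagingSymbol ω g) :=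
  ((memLp_cosTransform hg1 hg2).integrable_mul (memLp_cosTransform
    (integrable_indicator_one hω hfin) (memLp_indicator_one hω hfin))).const_mul _

lemma cosTransform_averagingSymbol (ω : Set V) (g : V → ℝ) (w : V) :
    cosTransform (averagingSymbol ω g) w = (volume.real ω)⁻¹ *
      cosTransform (fun ξ => cosTransform g ξ * cosTransform (ω.indicator 1) ξ) w :=
  cosTransform_const_mul _ _ _

lemma setAverage_image_add_left_comp_sub (hω : MeasurableSet ω) (hfin : volume ω ≠ ⊤)
    (hsymm : ∀ x ∈ ω, -x ∈ ω) (hg1 : Integrable g) (hg2 : MemLp g 2) (hge : g.Even) (y z : V) :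
    ⨍ x in (fun x => z + x) '' ω, g (x - y) = cosTransform (averagingSymbol ω g) (z - y) := by
  rw [setAverage_image_add_left hω, cosTransform_averagingSymbol,
    integral_comp_sub_mul_comp_sub hg1 hg2 hge (integrable_indicator_one hω hfin)
      (memLp_indicator_one hω hfin) (even_indicator_one hsymm)]

lemma integrable_cosTransform_averagingSymbol (hω : MeasurableSet ω) (hfin : volume ω ≠ ⊤)
    (hsymm : ∀ x ∈ ω, -x ∈ ω) (hg1 : Integrable g) (hg2 : MemLp g 2) (hge : g.Even) :
    Integrable (cosTransform (averagingSymbol ω g)) := by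
  rw [funext (cosTransform_averagingSymbol ω g)]
  exact (integrable_cosTransform_mul hg1 hg2 hge (integrable_indicator_one hω hfin)
    (memLp_indicator_one hω hfin) (even_indicator_one hsymm)).const_mul _

end Translates

end InnerProductSpace

variable {d : ℕ} {ω : Set (EuclideanSpace ℝ (Fin d))} {g : EuclideanSpace ℝ (Fin d) → ℝ}

lemma averagingSymbol_nonneg_of_isUniformAveragingKernel (hω : MeasurableSet ω)
    (hfin : volume ω ≠ ⊤) (hsymm : ∀ x ∈ ω, -x ∈ ω) (hg1 : Integrable g) (hg2 : MemLp g 2)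
    (hge : g.Even) (h : IsUniformAveragingKernel ω fun x y => g (x - y))
    (ξ : EuclideanSpace ℝ (Fin d)) : 0 ≤ averagingSymbol ω g ξ := by
  obtain ⟨X, -, lam, hlam, hrep⟩ := h
  choose k hk hlamk using hrep
  have hk_feature : IsFeatureMap (fun y => (k y : X.H)) (cosTransform (averagingSymbol ω g)) := by
    intro y z
    rw [← hlamk z, hlam, average_congr (ae_restrict_of_ae (hk y)),
      setAverage_image_add_left_comp_sub hω hfin hsymm hg1 hg2 hge]
  have hsymbol := integrable_averagingSymbol hω hfin hg1 hg2
  have hint := integrable_cosTransform_averagingSymbol hω hfin hsymm hg1 hg2 hge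
  rw [← cosTransform_cosTransform (continuous_averagingSymbol hω hfin hg1)
    (even_averagingSymbol ω g) hsymbol hint]
  exact hk_feature.cosTransform_nonneg (continuous_cosTransform hsymbol) hint ξ

lemma isUniformAveragingKernel_of_averagingSymbol_nonneg (hω : MeasurableSet ω)
    (hfin : volume ω ≠ ⊤) (hsymm : ∀ x ∈ ω, -x ∈ ω) (hpos : volume ω ≠ 0)
    (hne : ∀ᵐ ξ, cosTransform (ω.indicator 1) ξ ≠ 0) (hg1 : Integrable g) (hg2 : MemLp g 2)
    (hge : g.Even) (h : ∀ ξ, 0 ≤ averagingSymbol ω g ξ) :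
    IsUniformAveragingKernel ω fun x y => g (x - y) := by
  obtain ⟨v, hv, hv_ae⟩ :=
    exists_isFeatureMap_cosTransform (integrable_averagingSymbol hω hfin hg1 hg2) h
  let T (y : EuclideanSpace ℝ (Fin d)) : EuclideanSpace ℝ (Fin d) →ₘ[volume] ℝ :=
    AEEqFun.mk (fun x => g (x - y)) (hg1.comp_sub_right y).aestronglyMeasurable
  have hT (y) : T y =ᵐ[volume] fun x => g (x - y) := AEEqFun.coeFn_mk _ _
  have hT1 (y) : Integrable (T y) := (hg1.comp_sub_right y).congr (hT y).symm
  have hT2 (y) : MemLp (T y) 2 :=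
    (hg2.comp_measurePreserving (measurePreserving_sub_right volume y)).ae_eq (hT y).symm
  have hFT (y) : 𝓕 (fun x => (T y x : ℂ)) =
      (fun ξ => (𝐞 (-inner ℝ y ξ) : ℂ)) * fun ξ => (cosTransform g ξ : ℂ) :=
    (fourier_congr ((hT y).mono fun x hx => congrArg _ hx)).trans
      (funext (fourier_ofReal_comp_sub_right hg1 hge y))
  have hzero : ∀ᵐ ξ, (√(averagingSymbol ω g ξ) : ℂ) = 0 ↔ (cosTransform g ξ : ℂ) = 0 := by
    filter_upwards [hne] with ξ hξ
    have hvol : (volume.real ω)⁻¹ ≠ 0 := (inv_pos.2 (ENNReal.toReal_pos hpos hfin)).ne'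
    rw [Complex.ofReal_eq_zero, Complex.ofReal_eq_zero, Real.sqrt_eq_zero (h ξ), averagingSymbol,
      mul_eq_zero_iff_left hvol, mul_eq_zero_iff_right hξ]
  refine isAveragingKernel_of_inner_eq_setAverage v T hT
    (fun p => fst_eq_zero_iff_of_mem_span hv_ae hT1 hT2 hFT hzero)
    (fun y _ => (hT1 y).integrableOn) fun y z => ?_
  rw [hv, average_congr (ae_restrict_of_ae (hT y)),
    setAverage_image_add_left_comp_sub hω hfin hsymm hg1 hg2 hge]

/-- Necessity is positive definiteness of the Gram matrix of the representers, sufficiency realizes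
this Gram matrix in `L²`. -/
lemma isUniformAveragingKernel_sub_iff (hω : MeasurableSet ω) (hfin : volume ω ≠ ⊤)
    (hsymm : ∀ x ∈ ω, -x ∈ ω) (hpos : volume ω ≠ 0)
    (hne : ∀ᵐ ξ, cosTransform (ω.indicator 1) ξ ≠ 0) (hg1 : Integrable g) (hg2 : MemLp g 2)
    (hge : g.Even) : IsUniformAveragingKernel ω (fun x y => g (x - y)) ↔
      ∀ ξ, 0 ≤ cosTransform g ξ * cosTransform (ω.indicator 1) ξ := by
  simp only [← averagingSymbol_nonneg_iff hfin hpos]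
  exact ⟨averagingSymbol_nonneg_of_isUniformAveragingKernel hω hfin hsymm hg1 hg2 hge,
    isUniformAveragingKernel_of_averagingSymbol_nonneg hω hfin hsymm hpos hne hg1 hg2 hge⟩

end Averaging

section Truncation

lemma tendsto_eLpNorm_indicator_sub {X ι F : Type*} [MeasurableSpace X] {μ : Measure X}
    [NormedAddCommGroup F] {p : ℝ≥0∞} {l : Filter ι} [l.IsCountablyGenerated] {f : X → F}
    {s : ι → Set X} (hp : p ≠ ∞) (hf : MemLp f p μ) (hs : ∀ i, MeasurableSet (s i))
    (hmem : ∀ x, ∀ᶠ i in l, x ∈ s i) :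
    Tendsto (fun i => eLpNorm ((s i).indicator f - f) p μ) l (𝓝 0) := by
  rcases eq_or_ne p 0 with rfl | hp0
  · simp only [eLpNorm_exponent_zero, tendsto_const_nhds]
  have hp_pos : 0 < p.toReal := ENNReal.toReal_pos hp0 hp
  have hlint : Tendsto (fun i => ∫⁻ x, ‖((s i).indicator f - f) x‖ₑ ^ p.toReal ∂μ) l
      (𝓝 (∫⁻ _, 0 ∂μ)) := by
    refine tendsto_lintegral_filter_of_dominated_convergence' (fun x => ‖f x‖ₑ ^ p.toReal)
      (Eventually.of_forall fun i => ?_) (Eventually.of_forall fun i => ae_of_all _ fun x => ?_)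
      (lintegral_rpow_enorm_lt_top_of_eLpNorm_lt_top hp0 hp hf.2).ne (ae_of_all _ fun x => ?_)
    · exact ((hf.1.indicator (hs i)).sub hf.1).enorm.pow_const _
    · by_cases hx : x ∈ s i <;> simp [hx, hp_pos]
    · refine tendsto_const_nhds.congr' ?_
      filter_upwards [hmem x] with i hi
      simp [hi, hp_pos]
  simp only [eLpNorm_eq_lintegral_rpow_enorm_toReal hp0 hp]
  rw [lintegral_zero] at hlint
  have hrpow := (ENNReal.continuous_rpow_const (y := 1 / p.toReal)).tendsto 0
  rw [ENNReal.zero_rpow_of_pos (one_div_pos.2 hp_pos)] at hrpow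
  exact hrpow.comp hlint

lemma memLp_const_smul_iff {X F : Type*} [MeasurableSpace X] {μ : Measure X}
    [NormedAddCommGroup F] [NormedSpace ℝ F] {f : X → F} {p : ℝ≥0∞} {c : ℝ} (hc : c ≠ 0) :
    MemLp (c • f) p μ ↔ MemLp f p μ :=
  ⟨fun h => inv_smul_smul₀ hc f ▸ h.const_smul c⁻¹, fun h => h.const_smul c⟩

lemma memLp_comp_const_smul_iff {E F : Type*} [NormedAddCommGroup E] [NormedSpace ℝ E]
    [FiniteDimensional ℝ E] [MeasurableSpace E] [BorelSpace E] (μ : Measure E)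
    [μ.IsAddHaarMeasure] [NormedAddCommGroup F] {f : E → F} {p : ℝ≥0∞} {c : ℝ} (hc : c ≠ 0) :
    MemLp (fun x => f (c • x)) p μ ↔ MemLp f p μ := by
  have hscale : 0 < |(c ^ Module.finrank ℝ E)⁻¹| := abs_pos.2 (inv_ne_zero (pow_ne_zero _ hc))
  rw [← memLp_smul_measure_iff (f := f) (ENNReal.ofReal_pos.2 hscale).ne' ENNReal.ofReal_ne_top,
    ← Measure.map_addHaar_smul μ hc]
  exact ((MeasurableEquiv.smul₀ c hc).memLp_map_measure_iff (μ := μ) (g := f)).symm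

end Truncation

section Hankel

variable {d : ℕ}

lemma ae_radialMeasure_pos : ∀ᵐ r ∂(radialMeasure d), 0 < r := by
  refine (withDensity_absolutelyContinuous _ _).ae_le ?_
  rw [← restrict_Ioi_eq_restrict_Ici]
  exact ae_restrict_mem measurableSet_Ioi

lemma radialMeasure_Iic_ne_top (R : ℝ) : radialMeasure d (Iic R) ≠ ∞ := by
  rw [radialMeasure, withDensity_apply _ measurableSet_Iic,
    Measure.restrict_restrict measurableSet_Iic, inter_comm, Ici_inter_Iic]
  exact (continuous_pow (d - 1)).integrableOn_Icc.setLIntegral_lt_top.ne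

/-- The radial function on `ℝ^d` with profile `β`, rescaled so that its cosine transform, whose
kernel is `cos (2π⟨x, ξ⟩)`, is the Hankel transform of `β`, whose kernel involves `J(rs)`. -/
noncomputable def radialLift (d : ℕ) (β : ℝ → ℝ) (ξ : EuclideanSpace ℝ (Fin d)) : ℝ :=
  (2 * Real.pi) ^ ((d : ℝ) / 2) * β (2 * Real.pi * ‖ξ‖)

variable {β : ℝ → ℝ}

lemma even_radialLift (d : ℕ) (β : ℝ → ℝ) : (radialLift d β).Even := fun ξ => by
  rw [radialLift, radialLift, norm_neg]

lemma continuous_radialLift (hβ : ContinuousOn β (Ici 0)) : Continuous (radialLift d β) :=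
  continuous_const.mul (hβ.comp_continuous (by fun_prop) fun ξ => mem_Ici.2 (by positivity))

lemma radialLift_indicator_Iic (d : ℕ) (β : ℝ → ℝ) (R : ℝ) :
    radialLift d ((Iic R).indicator β) =
      {ξ | 2 * Real.pi * ‖ξ‖ ≤ R}.indicator (radialLift d β) := by
  ext ξ
  by_cases h : 2 * Real.pi * ‖ξ‖ ≤ R <;> simp [radialLift, h]

lemma truncatedHankel_eq (hd : 1 ≤ d) (β : ℝ → ℝ) (R : ℝ) {r : ℝ} (hr : 0 < r) :
    truncatedHankel d β R r = 2 ^ (1 - (d : ℝ) / 2) *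
      ∫ s in Ioc 0 R, β s * s ^ (d - 1) * reducedBesselJ ((d : ℝ) / 2 - 1) (s * r) := by
  rw [truncatedHankel, ← integral_const_mul, ← integral_const_mul]
  refine setIntegral_congr_fun measurableSet_Ioc fun s hs => ?_
  have hs0 : 0 < s := hs.1
  have hpow : s ^ (d - 1) = s ^ ((d : ℝ) / 2) * s ^ ((d : ℝ) / 2 - 1) := by
    rw [← Real.rpow_natCast, ← Real.rpow_add hs0, Nat.cast_sub hd]
    ring_nf
  have htwo : (2 : ℝ) ^ (1 - (d : ℝ) / 2) = (2 ^ ((d : ℝ) / 2 - 1))⁻¹ := by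
    rw [← Real.rpow_neg zero_le_two, neg_sub]
  have : r ^ ((d : ℝ) / 2 - 1) ≠ 0 := (Real.rpow_pos_of_pos hr _).ne'
  rw [besselJ_eq_rpow_mul (mul_pos hs0 hr), Real.div_rpow (mul_pos hs0 hr).le zero_le_two,
    Real.mul_rpow hs0.le hr.le, Real.rpow_neg hr.le, hpow, htwo]
  field_simp

variable [NeZero d]

lemma memLp_radialLift_iff {p : ℝ≥0∞} (hβ : AEStronglyMeasurable β (radialMeasure d)) :
    MemLp (radialLift d β) p ↔ MemLp β p (radialMeasure d) := by
  have h2π : 0 < 2 * Real.pi := by positivity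
  have hc : (2 * Real.pi) ^ ((d : ℝ) / 2) ≠ 0 := (Real.rpow_pos_of_pos h2π _).ne'
  have hlift : radialLift d β = fun ξ => ((2 * Real.pi) ^ ((d : ℝ) / 2) •
      fun x : EuclideanSpace ℝ (Fin d) => β ‖x‖) ((2 * Real.pi) • ξ) := by
    ext ξ
    rw [radialLift, Pi.smul_apply, norm_smul, Real.norm_of_nonneg h2π.le, smul_eq_mul]
  rw [hlift, memLp_comp_const_smul_iff volume h2π.ne', memLp_const_smul_iff hc]
  rw [← finrank_euclideanSpace_fin (𝕜 := ℝ) (n := d)] at hβ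
  simpa only [finrank_euclideanSpace_fin] using memLp_comp_norm_iff volume hβ

lemma memLp_radialLift_indicator_Iic (hβ2 : MemLp β 2 (radialMeasure d)) (R : ℝ) :
    MemLp (radialLift d ((Iic R).indicator β)) 2 :=
  have h := hβ2.indicator measurableSet_Iic
  (memLp_radialLift_iff h.1).2 h

lemma integrable_radialLift_indicator_Iic (hβ2 : MemLp β 2 (radialMeasure d)) (R : ℝ) :
    Integrable (radialLift d ((Iic R).indicator β)) := by
  have : IsFiniteMeasure ((radialMeasure d).restrict (Iic R)) :=
    isFiniteMeasure_restrict.2 (radialMeasure_Iic_ne_top R)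
  have h : MemLp ((Iic R).indicator β) 1 (radialMeasure d) :=
    (memLp_indicator_iff_restrict measurableSet_Iic).2 (hβ2.restrict _ |>.mono_exponent (by simp))
  exact memLp_one_iff_integrable.1 ((memLp_radialLift_iff h.1).2 h)

lemma tendsto_eLpNorm_radialLift_indicator_Iic_sub (hβ2 : MemLp β 2 (radialMeasure d)) :
    Tendsto (fun R => eLpNorm (radialLift d ((Iic R).indicator β) - radialLift d β) 2 volume)
      atTop (𝓝 0) := by
  simp only [radialLift_indicator_Iic]
  exact tendsto_eLpNorm_indicator_sub (by simp) ((memLp_radialLift_iff hβ2.1).2 hβ2)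
    (fun R => measurableSet_le (by fun_prop) measurable_const)
    fun ξ => eventually_ge_atTop (2 * Real.pi * ‖ξ‖)

lemma cosTransform_radialLift (hβ : Integrable (radialLift d β)) (x : EuclideanSpace ℝ (Fin d)) :
    cosTransform (radialLift d β) x = 2 ^ (1 - (d : ℝ) / 2) * ∫ s in Ioi 0,
      β s * s ^ (d - 1) * reducedBesselJ ((d : ℝ) / 2 - 1) (s * ‖x‖) := by
  have h2π : 0 < 2 * Real.pi := by positivity
  set c := (2 * Real.pi) ^ ((d : ℝ) / 2) with hc
  let F (s : ℝ) : ℝ := β s * s ^ (d - 1) * reducedBesselJ ((d : ℝ) / 2 - 1) (s * ‖x‖)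
  have hpolar := integral_radial_mul_cos (f := fun r => c * β (2 * Real.pi * r)) hβ
    ((2 * Real.pi) • x)
  simp only [finrank_euclideanSpace_fin, real_inner_smul_right, norm_smul,
    Real.norm_of_nonneg h2π.le] at hpolar
  have hscale (r : ℝ) : c * β (2 * Real.pi * r) * r ^ (d - 1) *
      reducedBesselJ ((d : ℝ) / 2 - 1) (r * (2 * Real.pi * ‖x‖)) =
        c / (2 * Real.pi) ^ (d - 1) * F (2 * Real.pi * r) := by
    simp only [F, mul_pow (2 * Real.pi) r, mul_left_comm r, ← mul_assoc]
    field_simp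
  have hpow : (2 * Real.pi) ^ (d - 1) * (2 * Real.pi) = c * c := by
    rw [← pow_succ, Nat.sub_add_cancel NeZero.one_le, hc, ← Real.rpow_natCast,
      ← Real.rpow_add h2π, add_halves]
  have hconst : 2 * Real.pi ^ ((d : ℝ) / 2) * (c / (2 * Real.pi) ^ (d - 1) * (2 * Real.pi)⁻¹) =
      2 ^ (1 - (d : ℝ) / 2) := by
    rw [div_mul_eq_mul_div, ← div_eq_mul_inv, div_div, mul_comm (2 * Real.pi), hpow,
      Real.rpow_sub two_pos, Real.rpow_one, hc, Real.mul_rpow zero_le_two Real.pi_pos.le]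
    field_simp
  rw [funext hscale, integral_const_mul, integral_comp_mul_left_Ioi F 0 h2π, mul_zero,
    smul_eq_mul, ← mul_assoc, ← mul_assoc, mul_assoc (2 * _), hconst] at hpolar
  exact hpolar

lemma cosTransform_radialLift_indicator_Iic (hβ2 : MemLp β 2 (radialMeasure d)) (R : ℝ)
    {x : EuclideanSpace ℝ (Fin d)} (hx : x ≠ 0) :
    cosTransform (radialLift d ((Iic R).indicator β)) x = truncatedHankel d β R ‖x‖ := by
  rw [cosTransform_radialLift (integrable_radialLift_indicator_Iic hβ2 R),
    truncatedHankel_eq NeZero.one_le β R (norm_pos_iff.2 hx), ← Ioi_inter_Iic,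
    ← setIntegral_indicator measurableSet_Iic]
  simp only [indicator_mul_left]

lemma aestronglyMeasurable_truncatedHankel (hβ2 : MemLp β 2 (radialMeasure d)) (R : ℝ) :
    AEStronglyMeasurable (truncatedHankel d β R) (radialMeasure d) := by
  obtain ⟨u, hu⟩ := exists_norm_eq (EuclideanSpace ℝ (Fin d)) zero_le_one
  have hcont : Continuous fun r : ℝ => cosTransform (radialLift d ((Iic R).indicator β)) (r • u) :=
    (continuous_cosTransform (integrable_radialLift_indicator_Iic hβ2 R)).comp (by fun_prop)
  refine hcont.aestronglyMeasurable.congr ?_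
  filter_upwards [ae_radialMeasure_pos] with r hr
  have hnorm : ‖r • u‖ = r := by rw [norm_smul, hu, mul_one, Real.norm_of_nonneg hr.le]
  rw [cosTransform_radialLift_indicator_Iic hβ2 R (norm_pos_iff.1 (hnorm.symm ▸ hr)), hnorm]

end Hankel

section Plancherel

lemma tendsto_eLpNorm_sub_iff_ae_eq {X ι F : Type*} [MeasurableSpace X] {μ : Measure X}
    [NormedAddCommGroup F] {p : ℝ≥0∞} {l : Filter ι} [l.NeBot] {f : ι → X → F} {b c : X → F}
    (hp : 1 ≤ p) (hf : ∀ i, AEStronglyMeasurable (f i) μ) (hb : AEStronglyMeasurable b μ)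
    (hc : AEStronglyMeasurable c μ) (hlim : Tendsto (fun i => eLpNorm (f i - b) p μ) l (𝓝 0)) :
    Tendsto (fun i => eLpNorm (f i - c) p μ) l (𝓝 0) ↔ b =ᵐ[μ] c := by
  refine ⟨fun h => ?_, fun h => hlim.congr fun i => eLpNorm_congr_ae (h.mono fun x hx => by
    rw [Pi.sub_apply, Pi.sub_apply, hx])⟩
  have hle (i : ι) : eLpNorm (b - c) p μ ≤ eLpNorm (f i - b) p μ + eLpNorm (f i - c) p μ := by
    rw [eLpNorm_sub_comm (f i) b, ← sub_add_sub_cancel b (f i) c]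
    exact eLpNorm_add_le (hb.sub (hf i)) ((hf i).sub hc) hp
  have hzero : eLpNorm (b - c) p μ = 0 :=
    le_zero_iff.1 (ge_of_tendsto' (add_zero (0 : ℝ≥0∞) ▸ hlim.add h) hle)
  rw [eLpNorm_eq_zero_iff (hb.sub hc) (zero_lt_one.trans_le hp).ne'] at hzero
  exact hzero.mono fun x hx => sub_eq_zero.1 hx

variable {V : Type*} [NormedAddCommGroup V] [InnerProductSpace ℝ V] [FiniteDimensional ℝ V]
  [MeasurableSpace V] [BorelSpace V]

lemma eLpNorm_cosTransform_sub {g h : V → ℝ} (hg1 : Integrable g) (hg2 : MemLp g 2)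
    (hge : g.Even) (hh1 : Integrable h) (hh2 : MemLp h 2) (hhe : h.Even) :
    eLpNorm (cosTransform h - g) 2 volume = eLpNorm (h - cosTransform g) 2 volume := by
  have hh1c : Integrable (fun x => (h x : ℂ)) := hh1.ofReal
  have hh2c : MemLp (fun x => (h x : ℂ)) 2 volume := hh2.ofReal (K := ℂ)
  have hg1c : Integrable (fun x => (g x : ℂ)) := hg1.ofReal
  have hg2c : MemLp (fun x => (g x : ℂ)) 2 volume := hg2.ofReal (K := ℂ)
  have hinv : 𝓕 (𝓕⁻ hg2c.toLp : Lp ℂ 2 (volume : Measure V)) = hg2c.toLp :=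
    FourierTransform.fourier_fourierInv_eq hg2c.toLp
  have hisom : edist (𝓕 hh2c.toLp : Lp ℂ 2 (volume : Measure V)) hg2c.toLp =
      edist hh2c.toLp (𝓕⁻ hg2c.toLp : Lp ℂ 2 (volume : Measure V)) :=
    (congrArg (edist _) hinv.symm).trans ((Lp.fourierTransformₗᵢ V ℂ).edist_map _ _)
  rw [Lp.edist_def, Lp.edist_def] at hisom
  refine Eq.trans (eLpNorm_congr_norm_ae ?_) (hisom.trans (eLpNorm_congr_norm_ae ?_))
  · filter_upwards [fourier_toLp_ae_eq hh1c hh2c, hg2c.coeFn_toLp] with x hx hy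
    rw [Pi.sub_apply, Pi.sub_apply, hx, hy, fourier_ofReal_eq_cosTransform hh1 hhe,
      ← Complex.ofReal_sub, Complex.norm_real]
  · filter_upwards [fourierInv_toLp_ae_eq hg1c hg2c, hh2c.coeFn_toLp] with x hx hy
    rw [Pi.sub_apply, Pi.sub_apply, hx, hy, fourierInv_ofReal_eq_cosTransform hg1 hge,
      ← Complex.ofReal_sub, Complex.norm_real]

end Plancherel

section Main

variable {d : ℕ} [NeZero d] {α β : ℝ → ℝ}

lemma memLp_comp_norm {p : ℝ≥0∞} (hα : MemLp α p (radialMeasure d)) :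
    MemLp (fun x : EuclideanSpace ℝ (Fin d) => α ‖x‖) p := by
  rw [← finrank_euclideanSpace_fin (𝕜 := ℝ) (n := d)] at hα
  exact (memLp_comp_norm_iff volume hα.1).2 hα

lemma isInverseHankelTransform_iff_tendsto (hα2 : MemLp α 2 (radialMeasure d))
    (hβ2 : MemLp β 2 (radialMeasure d)) :
    IsInverseHankelTransform d β α ↔ Tendsto (fun R => eLpNorm
      (cosTransform (radialLift d ((Iic R).indicator β)) - fun x => α ‖x‖) 2 volume)
        atTop (𝓝 0) := by
  set C : ℝ≥0∞ :=
    (volume : Measure (EuclideanSpace ℝ (Fin d))).toSphere univ ^ (1 / (2 : ℝ≥0∞)).toReal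
  have hC : C ≠ ∞ := ENNReal.rpow_ne_top_of_nonneg ENNReal.toReal_nonneg (measure_ne_top _ _)
  have hC0 : C ≠ 0 := (ENNReal.rpow_pos (pos_iff_ne_zero.2 (toSphere_univ_ne_zero _))
    (measure_ne_top _ _)).ne'
  have hradial (R : ℝ) :
      eLpNorm (cosTransform (radialLift d ((Iic R).indicator β)) - fun x => α ‖x‖) 2 volume =
        C * eLpNorm (fun r => truncatedHankel d β R r - α r) 2 (radialMeasure d) := by
    have hmeas := (aestronglyMeasurable_truncatedHankel hβ2 R).sub hα2.1
    rw [← finrank_euclideanSpace_fin (𝕜 := ℝ) (n := d)] at hmeas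
    have hpolar := eLpNorm_comp_norm volume (p := 2) ENNReal.ofNat_ne_top hmeas
    rw [finrank_euclideanSpace_fin] at hpolar
    refine Eq.trans (eLpNorm_congr_ae ?_) hpolar
    filter_upwards [compl_mem_ae_iff.2 (measure_singleton 0)] with x hx
    rw [Pi.sub_apply, Pi.sub_apply, cosTransform_radialLift_indicator_Iic hβ2 R hx]
  simp only [hradial, IsInverseHankelTransform]
  refine ⟨fun h => by simpa using ENNReal.Tendsto.const_mul h (Or.inr hC), fun h => ?_⟩
  simpa [← mul_assoc, ENNReal.inv_mul_cancel hC0 hC] using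
    ENNReal.Tendsto.const_mul h (Or.inr (ENNReal.inv_ne_top.2 hC0))

lemma isInverseHankelTransform_iff (hα1 : MemLp α 1 (radialMeasure d))
    (hα2 : MemLp α 2 (radialMeasure d)) (hβ2 : MemLp β 2 (radialMeasure d)) :
    IsInverseHankelTransform d β α ↔
      radialLift d β =ᵐ[volume] cosTransform fun x => α ‖x‖ := by
  have hg1 : Integrable fun x : EuclideanSpace ℝ (Fin d) => α ‖x‖ :=
    memLp_one_iff_integrable.1 (memLp_comp_norm hα1)
  have hge : (fun x : EuclideanSpace ℝ (Fin d) => α ‖x‖).Even :=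
    fun x => congrArg α (norm_neg x)
  rw [isInverseHankelTransform_iff_tendsto hα2 hβ2,
    tendsto_congr fun R => eLpNorm_cosTransform_sub hg1 (memLp_comp_norm hα2) hge
      (integrable_radialLift_indicator_Iic hβ2 R) (memLp_radialLift_indicator_Iic hβ2 R)
      (even_radialLift d _)]
  exact tendsto_eLpNorm_sub_iff_ae_eq one_le_two
    (fun R => (memLp_radialLift_indicator_Iic hβ2 R).1) ((memLp_radialLift_iff hβ2.1).2 hβ2).1
    (continuous_cosTransform hg1).aestronglyMeasurable
    (tendsto_eLpNorm_radialLift_indicator_Iic_sub hβ2)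

lemma hasBesselSignPattern_iff_radialLift {a : ℝ} (ha : 0 < a) (hβ : ContinuousOn β (Ici 0)) :
    HasBesselSignPattern d a β ↔ ∀ ξ : EuclideanSpace ℝ (Fin d),
      0 ≤ radialLift d β ξ * reducedBesselJ ((d : ℝ) / 2) (a * (2 * Real.pi * ‖ξ‖)) := by
  have hc : 0 < (2 * Real.pi) ^ ((d : ℝ) / 2) := Real.rpow_pos_of_pos Real.two_pi_pos _
  simp only [hasBesselSignPattern_iff ha hβ, radialLift, mul_assoc _ (β _),
    mul_nonneg_iff_of_pos_left hc]
  refine ⟨fun h ξ => h _ (by positivity), fun h s hs => ?_⟩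
  obtain ⟨ξ, hξ⟩ := exists_norm_eq (EuclideanSpace ℝ (Fin d))
    (div_nonneg hs Real.two_pi_pos.le)
  simpa only [hξ, mul_div_cancel₀ s Real.two_pi_pos.ne'] using h ξ

lemma cosTransform_indicator_closedBall {a : ℝ} (ha : 0 ≤ a) (ξ : EuclideanSpace ℝ (Fin d)) :
    cosTransform ((Metric.closedBall 0 a).indicator 1) ξ =
      Real.pi ^ ((d : ℝ) / 2) * a ^ d *
        reducedBesselJ ((d : ℝ) / 2) (a * (2 * Real.pi * ‖ξ‖)) := by
  have h := setIntegral_closedBall_cos ha ((2 * Real.pi) • ξ)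
  rw [norm_smul, Real.norm_of_nonneg Real.two_pi_pos.le, finrank_euclideanSpace_fin,
    ← integral_indicator Metric.isClosed_closedBall.measurableSet] at h
  rw [← h, cosTransform]
  congr 1 with x
  by_cases hx : x ∈ Metric.closedBall 0 a <;> simp [hx, real_inner_smul_right]

lemma ae_reducedBesselJ_mul_norm_ne_zero {ν : ℝ} (hν : -1 < ν) (a : ℝ) :
    ∀ᵐ ξ : EuclideanSpace ℝ (Fin d), reducedBesselJ ν (a * (2 * Real.pi * ‖ξ‖)) ≠ 0 := by
  have hnull := (countable_setOf_reducedBesselJ_mul_eq_zero hν (a * (2 * Real.pi))).measure_zero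
    volume
  have hradial : radialMeasure (Module.finrank ℝ (EuclideanSpace ℝ (Fin d)))
      {s | reducedBesselJ ν (a * (2 * Real.pi) * s) = 0} = 0 :=
    withDensity_absolutelyContinuous _ _ (Measure.restrict_le_self.absolutelyContinuous hnull)
  filter_upwards [(quasiMeasurePreserving_norm volume).ae
    (measure_eq_zero_iff_ae_notMem.1 hradial)] with ξ hξ
  rwa [← mul_assoc]

lemma generatesRadialAveragingKernel_iff {a : ℝ} (ha : 0 < a)
    (hα1 : MemLp α 1 (radialMeasure d)) (hα2 : MemLp α 2 (radialMeasure d)) :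
    GeneratesRadialAveragingKernel d a α ↔ ∀ ξ : EuclideanSpace ℝ (Fin d),
      0 ≤ cosTransform (fun x => α ‖x‖) ξ *
        reducedBesselJ ((d : ℝ) / 2) (a * (2 * Real.pi * ‖ξ‖)) := by
  have hc : 0 < Real.pi ^ ((d : ℝ) / 2) * a ^ d :=
    mul_pos (Real.rpow_pos_of_pos Real.pi_pos _) (pow_pos ha d)
  have hν : -1 < (d : ℝ) / 2 := neg_one_lt_zero.trans_le (by positivity)
  have hiff := isUniformAveragingKernel_sub_iff (ω := Metric.closedBall 0 a)
    Metric.isClosed_closedBall.measurableSet measure_closedBall_lt_top.ne (by simp)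
    (Metric.measure_closedBall_pos volume 0 ha).ne'
    ((ae_reducedBesselJ_mul_norm_ne_zero hν a).mono fun ξ hξ => by
      rw [cosTransform_indicator_closedBall ha.le]
      exact mul_ne_zero hc.ne' hξ)
    (memLp_one_iff_integrable.1 (memLp_comp_norm hα1)) (memLp_comp_norm hα2)
    fun x => congrArg α (norm_neg x)
  simpa only [GeneratesRadialAveragingKernel, cosTransform_indicator_closedBall ha.le,
    mul_left_comm _ (_ * a ^ d), mul_nonneg_iff_of_pos_left hc] using hiff

lemma cosTransform_comp_norm_eq {V : Type*} [NormedAddCommGroup V] [InnerProductSpace ℝ V]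
    [FiniteDimensional ℝ V] [MeasurableSpace V] [BorelSpace V] (f : ℝ → ℝ) {ξ η : V}
    (h : ‖ξ‖ = ‖η‖) :
    cosTransform (fun x : V => f ‖x‖) ξ = cosTransform (fun x : V => f ‖x‖) η := by
  obtain ⟨A, rfl⟩ : ∃ A : V ≃ₗᵢ[ℝ] V, A ξ = η := ⟨_, Submodule.reflection_sub h⟩
  rw [cosTransform, cosTransform,
    ← A.measurePreserving.integral_comp A.toHomeomorph.measurableEmbedding
      fun x => f ‖x‖ * Real.cos (2 * Real.pi * inner ℝ x (A ξ))]
  simp only [A.norm_map, A.inner_map_map]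

lemma exists_radialLift_eq_cosTransform
    (hα : Integrable fun x : EuclideanSpace ℝ (Fin d) => α ‖x‖) :
    ∃ β : ℝ → ℝ, Continuous β ∧ Tendsto β atTop (𝓝 0) ∧
      radialLift d β = cosTransform fun x => α ‖x‖ := by
  have hc : (2 * Real.pi) ^ ((d : ℝ) / 2) ≠ 0 := (Real.rpow_pos_of_pos Real.two_pi_pos _).ne'
  obtain ⟨u, hu⟩ := exists_norm_eq (EuclideanSpace ℝ (Fin d)) zero_le_one
  have hnorm (s : ℝ) : ‖((2 * Real.pi)⁻¹ * s) • u‖ = (2 * Real.pi)⁻¹ * |s| := by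
    rw [norm_smul, hu, mul_one, norm_mul, Real.norm_of_nonneg (by positivity), Real.norm_eq_abs]
  have hray : Tendsto (fun s : ℝ => ((2 * Real.pi)⁻¹ * s) • u) atTop (cocompact _) := by
    rw [← Metric.cobounded_eq_cocompact, ← tendsto_norm_atTop_iff_cobounded]
    simp only [hnorm]
    exact tendsto_abs_atTop_atTop.const_mul_atTop (inv_pos.2 Real.two_pi_pos)
  refine ⟨fun s => ((2 * Real.pi) ^ ((d : ℝ) / 2))⁻¹ *
    cosTransform (fun x => α ‖x‖) (((2 * Real.pi)⁻¹ * s) • u), ?_, ?_, ?_⟩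
  · exact continuous_const.mul ((continuous_cosTransform hα).comp (by fun_prop))
  · simpa using ((tendsto_cosTransform_cocompact hα).comp hray).const_mul _
  · ext ξ
    rw [radialLift, mul_inv_cancel_left₀ hc]
    refine cosTransform_comp_norm_eq α ?_
    rw [hnorm, abs_of_nonneg (by positivity), inv_mul_cancel_left₀ Real.two_pi_pos.ne']

end Main

theorem mainTheorem3 (d : ℕ) (hd : 1 ≤ d) (a : ℝ) (ha : 0 < a) (α : ℝ → ℝ)
    (hα1 : MemLp α 1 (radialMeasure d)) (hα2 : MemLp α 2 (radialMeasure d))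
    (hα0 : ¬ α =ᵐ[radialMeasure d] 0) :
    GeneratesRadialAveragingKernel d a α ↔
      ∃ β : ℝ → ℝ, ContinuousOn β (Ici 0) ∧ Tendsto β atTop (𝓝 0) ∧
        MemLp β 2 (radialMeasure d) ∧ IsInverseHankelTransform d β α ∧
        HasBesselSignPattern d a β := by
  have : NeZero d := ⟨Nat.one_le_iff_ne_zero.1 hd⟩
  have hg1 : Integrable fun x : EuclideanSpace ℝ (Fin d) => α ‖x‖ :=
    memLp_one_iff_integrable.1 (memLp_comp_norm hα1)
  rw [generatesRadialAveragingKernel_iff ha hα1 hα2]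
  constructor
  · intro hnonneg
    obtain ⟨β, hβ, hβ0, hlift⟩ := exists_radialLift_eq_cosTransform hg1
    have hβ2 : MemLp β 2 (radialMeasure d) := (memLp_radialLift_iff hβ.aestronglyMeasurable).1
      (hlift ▸ memLp_cosTransform hg1 (memLp_comp_norm hα2))
    exact ⟨β, hβ.continuousOn, hβ0, hβ2,
      (isInverseHankelTransform_iff hα1 hα2 hβ2).2 hlift.eventuallyEq,
      (hasBesselSignPattern_iff_radialLift ha hβ.continuousOn).2 (hlift ▸ hnonneg)⟩
  · rintro ⟨β, hβ, -, hβ2, hHankel, hsign⟩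
    have hlift : radialLift d β = cosTransform fun x => α ‖x‖ :=
      ((continuous_radialLift hβ).ae_eq_iff_eq volume (continuous_cosTransform hg1)).1
        ((isInverseHankelTransform_iff hα1 hα2 hβ2).1 hHankel)
    exact hlift ▸ (hasBesselSignPattern_iff_radialLift ha hβ).1 hsign
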